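/- For $p=(x,y)\in\mathbb{R}^2\setminus\{0\}$ let $K(x,y)=\frac{xy}{2\pi(x^2+y^2)^2}$, and for a Schwartz function $f\in\mathcal{S}(\mathbb{R}^2)$ let $$R_{12}f(p)=\lim_{\epsilon\to0^+}\int_{|p-q|>\epsilon}K(p-q)f(q)\,dq$$ be the double Riesz transform with kernel $K$; this limit exists for every $f\in\mathcal{S}(\mathbb{R}^2)$ and every $p\in\mathbb{R}^2$. Then there is a sequence of Schwartz functions $g_n\in\mathcal{S}(\mathbb{R}^2)$, $n\in\mathbb{N}$, such that $$\sup_n\bigl\|\,\|e^{x^2+y^2}g_n(x,y)\|_{L^\infty_y}\bigr\|_{L^\infty_x}<\infty,\qquad \bigl\|\,\|R_{12}g_n(x,y)\|_{L^2_x}\bigr\|_{L^\infty_y}<\infty\ \text{ for every } n,\qquad \bigl\|\,\|R_{12}g_n(x,y)\|_{L^2_x}\bigr\|_{L^\infty_y}\to\infty\ \text{ as } n\to\infty.$$ Moreover, the $g_n$ can be taken of the following form, for some $A\in[3,100]$: $$g_n(x,y)=\sum_{j=100}^{n}\chi_1^{(j)}(y)\,e^{-x^2}\,\mathcal{F}^{-1}\bigl(\chi_3^{(j)}\bigr)(x),\qquad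 \chi_3^{(j)}(\xi)=\chi(\xi-2^j)+\chi(-\xi-2^j),$$ (an empty sum being $0$), where $\mathcal{F}^{-1}(\varphi)(x)=\frac{1}{\sqrt{2\pi}}\int_{\mathbb{R}} e^{ix\xi}\varphi(\xi)\,d\xi$, $\chi:\mathbb{R}\to[0,1]$ is smooth, supported on $[0,A]$ and equal to $1$ on $[\frac14,A-\frac14]$, and each $\chi_1^{(j)}:\mathbb{R}\to[0,1]$ is smooth, supported on $[2^{-j},2^{-j+1}]$ and equal to $1$ on $[2^{-j}+2^{-j-10},\,2^{-j+1}-2^{-j-10}]$. Consequently there is no constant $C<\infty$ such that $\bigl\|\,\|R_{12}f\|_{L^2_x}\bigr\|_{L^\infty_y}\le C\bigl\|\,\|e^{x^2+y^2}f\|_{L^\infty_y}\bigr\|_{L^\infty_x}$ for all $f\in\mathcal{S}(\mathbb{R}^2)$, and no constant $C<\infty$ such that $\bigl\|\,\|R_{12}f\|_{L^2_x}\bigr\|_{L^\infty_y}\le C\bigl\|\,\|f\|_{L^\infty_y}\bigr\|_{L^2_x}$ for all $f\in\mathcal{S}(\mathbb{R}^2)$. -/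

import Mathlib

open MeasureTheory Filter Topology
open scoped ENNReal NNReal SchwartzMap

noncomputable section

namespace DoubleRiesz

/-- The kernel `K(x, y) = x y / (2 π (x² + y²)²)`. -/
def kernel (p : ℝ × ℝ) : ℝ :=
  p.1 * p.2 / (2 * Real.pi * (p.1 ^ 2 + p.2 ^ 2) ^ 2)

/-- The truncated integral of `K(p - q) f(q)` over `|p - q| > ε`, where `|·|` is the Euclidean
norm of the plane (the norm of `ℝ × ℝ` is the sup norm, so the condition is written out). -/
def truncated (f : ℝ × ℝ → ℂ) (ε : ℝ) (p : ℝ × ℝ) : ℂ :=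
  ∫ q in {q : ℝ × ℝ | ε < Real.sqrt ((p.1 - q.1) ^ 2 + (p.2 - q.2) ^ 2)},
    (kernel (p - q) : ℂ) * f q

/-- The double Riesz transform: the limit of the truncated integrals as `ε → 0+`. -/
def R₁₂ (f : ℝ × ℝ → ℂ) (p : ℝ × ℝ) : ℂ :=
  limUnder (𝓝[>] (0 : ℝ)) fun ε => truncated f ε p

/-- The mixed norm `‖ ‖F(x, y)‖_{L^p_x} ‖_{L^q_y}` (inner norm in `x`, outer norm in `y`). -/
def normXthenY (p q : ℝ≥0∞) (F : ℝ × ℝ → ℂ) : ℝ≥0∞ :=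
  eLpNorm (fun y : ℝ => eLpNorm (fun x : ℝ => F (x, y)) p volume) q volume

/-- The mixed norm `‖ ‖F(x, y)‖_{L^p_y} ‖_{L^q_x}` (inner norm in `y`, outer norm in `x`). -/
def normYthenX (p q : ℝ≥0∞) (F : ℝ × ℝ → ℂ) : ℝ≥0∞ :=
  eLpNorm (fun x : ℝ => eLpNorm (fun y : ℝ => F (x, y)) p volume) q volume

/-- The function `e^{x² + y²} f(x, y)`. -/
def gaussWeighted (f : ℝ × ℝ → ℂ) (p : ℝ × ℝ) : ℂ :=
  (Real.exp (p.1 ^ 2 + p.2 ^ 2) : ℂ) * f p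

/-- `φ` is a smooth bump function with values in `[0, 1]`, supported on `[a, b]` and equal to `1`
on `[c, d]`. -/
def IsBump (φ : ℝ → ℝ) (a b c d : ℝ) : Prop :=
  ContDiff ℝ (⊤ : ℕ∞) φ ∧ (∀ t, φ t ∈ Set.Icc (0 : ℝ) 1) ∧ Function.support φ ⊆ Set.Icc a b ∧
    ∀ t ∈ Set.Icc c d, φ t = 1

/-- The one-dimensional inverse Fourier transform `(2π)^{-1/2} ∫ e^{i x ξ} φ(ξ) dξ`. -/
def invFourier (φ : ℝ → ℝ) (x : ℝ) : ℂ :=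
  ((Real.sqrt (2 * Real.pi))⁻¹ : ℝ) *
    ∫ ξ : ℝ, Complex.exp (Complex.I * (x : ℂ) * (ξ : ℂ)) * (φ ξ : ℂ)

/-- The frequency cutoff at `ξ ~ ±2^j` made from translates of `χ` and of its reflection. -/
def freqCutoff (χ : ℝ → ℝ) (j : ℕ) (ξ : ℝ) : ℝ :=
  χ (ξ - 2 ^ j) + χ (-ξ - 2 ^ j)

/-- The tensor bump `ψ(y) e^{-x²} 𝓕⁻¹(freqCutoff χ j)(x)`. -/
def tensorBump (χ ψ : ℝ → ℝ) (j : ℕ) (p : ℝ × ℝ) : ℂ :=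
  (ψ p.2 : ℂ) * (Real.exp (-p.1 ^ 2) : ℂ) * invFourier (freqCutoff χ j) p.1

end DoubleRiesz

end

noncomputable section

namespace DoubleRiesz

/-! The divergence comes from duality in `x` on a horizontal line just below the supports. For `y <
0` the singularity is never met, and for `Y > 0` the kernel is a Laplace transform, `K(u, -Y) =
-(1/4π) ∫_0^∞ s e^{-Ys} sin(us) ds` (`kernel_eq_integral`). Pairing it with a function `h` and an
even profile `a` separates the variables: the result is `-(1/4π) ∫ s e^{-Ys} S(s) C(s) ds`, with `S`
the sine transform of `h` and `C` the cosine transform of `a` (`integral_pairing_kernel`).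

Take `h = ∑_k sin(2^k x) e^{-x²}`. Then `S` and the cosine transforms of all profiles are
nonnegative, so nothing cancels between scales, and on `[2^j, 2^j + 1]` both are bounded below. With
`Y ≲ 2^{-j}` the pairing at scale `j` has size at least `c 2^j`. Integrating over the shell, of
thickness about `2^{-j}`, leaves a constant (`exists_integral_testFun_mul_shellTransform_le`). The
scales `100, …, n` add up to about `n`, whereas almost orthogonality gives `‖h‖₂ ≤ √(n + 128)`
(`integral_testFun_sq_le`). By Cauchy-Schwarz the `L²_x` norm is at least of order `√n` for every `y
∈ (-2^{-n}, 0)`, an interval that the essential supremum sees.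

The inputs remain bounded because the shells are disjoint: at each point at most one bump is
nonzero, so `|g_n| ≤ C e^{-x²-y²}` uniformly in `n`. This bounds both right-hand norms and refutes
both estimates.

Existence of the principal value and finiteness of each norm use the oddness of `K` in its first
variable: antisymmetrizing gives an absolutely convergent integral, bounded by a multiple of `1/(1 +
x²)` uniformly in `y` (`exists_norm_symmIntegrand_le`). -/

/-! ### ### Cauchy weights -/

/-- The Cauchy weight `1 / (1 + t²)`. -/
def cauchyWeight (t : ℝ) : ℝ := (1 + t ^ 2)⁻¹

lemma cauchyWeight_pos (t : ℝ) : 0 < cauchyWeight t := by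
  unfold cauchyWeight; positivity

lemma integrable_cauchyWeight : Integrable cauchyWeight := integrable_inv_one_add_sq

lemma cauchyWeight_neg (t : ℝ) : cauchyWeight (-t) = cauchyWeight t := by
  simp [cauchyWeight]

/-- Peetre's inequality for the Cauchy weight. -/
lemma cauchyWeight_mul_le (x t : ℝ) :
    cauchyWeight t * cauchyWeight (x - t) ≤ 2 * cauchyWeight x := by
  unfold cauchyWeight
  rw [← mul_inv, ← div_eq_mul_inv, inv_eq_one_div, div_le_div_iff₀ (by positivity) (by positivity)]
  nlinarith [sq_nonneg (x - 2 * t), sq_nonneg (t * (x - t))]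

lemma cauchyWeight_le_of_abs_le_one {x t : ℝ} (ht : |t - x| ≤ 1) :
    cauchyWeight t ≤ 4 * cauchyWeight x := by
  have h1 := cauchyWeight_mul_le x (x - t)
  have h2 : (1 / 2 : ℝ) ≤ cauchyWeight (x - t) := by
    unfold cauchyWeight
    rw [inv_eq_one_div]
    apply one_div_le_one_div_of_le (by positivity)
    have : (x - t) ^ 2 ≤ 1 := by
      rw [abs_sub_comm] at ht
      exact (sq_le_one_iff_abs_le_one _).2 ht
    linarith
  have h3 : x - (x - t) = t := by ring
  rw [h3] at h1
  nlinarith [cauchyWeight_pos t]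

/-! ### The kernel -/

@[fun_prop]
lemma measurable_kernel : Measurable kernel := by
  unfold kernel; fun_prop

/-- Reflection in the second coordinate axis. -/
def reflectFst : ℝ × ℝ ≃ᵐ ℝ × ℝ :=
  (MeasurableEquiv.neg ℝ).prodCongr (MeasurableEquiv.refl ℝ)

@[simp] lemma reflectFst_apply (q : ℝ × ℝ) : reflectFst q = (-q.1, q.2) := rfl

lemma measurePreserving_reflectFst : MeasurePreserving reflectFst volume volume :=
  (Measure.measurePreserving_neg (volume : Measure ℝ)).prod (MeasurePreserving.id volume)

/-- This oddness is the only cancellation behind the principal value. -/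
lemma kernel_reflectFst (q : ℝ × ℝ) : kernel (reflectFst q) = -kernel q := by
  simp [kernel, neg_div]

@[simp] lemma kernel_zero : kernel 0 = 0 := by simp [kernel]

lemma abs_kernel_le (q : ℝ × ℝ) : |kernel q| ≤ (q.1 ^ 2 + q.2 ^ 2)⁻¹ := by
  unfold kernel
  rcases eq_or_lt_of_le (show 0 ≤ q.1 ^ 2 + q.2 ^ 2 by positivity) with h | h
  · simp [← h]
  have hpi := Real.pi_gt_three
  rw [abs_div, abs_of_pos (show 0 < 2 * Real.pi * (q.1 ^ 2 + q.2 ^ 2) ^ 2 by positivity),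
    inv_eq_one_div, div_le_div_iff₀ (by positivity) h, one_mul, abs_mul]
  have h1 : |q.1| * |q.2| ≤ q.1 ^ 2 + q.2 ^ 2 := by
    nlinarith [sq_nonneg (|q.1| - |q.2|), sq_abs q.1, sq_abs q.2, sq_nonneg q.1, sq_nonneg q.2]
  calc |q.1| * |q.2| * (q.1 ^ 2 + q.2 ^ 2)
      ≤ (q.1 ^ 2 + q.2 ^ 2) * (q.1 ^ 2 + q.2 ^ 2) := by gcongr
    _ ≤ _ := by nlinarith [sq_nonneg (q.1 ^ 2 + q.2 ^ 2)]

/-- Away from the origin only decay in the first variable is kept; integrability in the second will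
come from the Schwartz function. -/
lemma abs_kernel_le_cauchyWeight {q : ℝ × ℝ} (hq : 1 ≤ q.1 ^ 2 + q.2 ^ 2) :
    |kernel q| ≤ 2 * cauchyWeight q.1 := by
  refine (abs_kernel_le q).trans ?_
  unfold cauchyWeight
  rw [← div_eq_mul_inv, inv_eq_one_div, div_le_div_iff₀ (by positivity) (by positivity)]
  nlinarith [sq_nonneg q.2]

/-- An integrable majorant of the singularity `|q|⁻¹` on the unit square. -/
def squareMajorant (q : ℝ × ℝ) : ℝ :=
  (Set.Icc (-1 : ℝ) 1).indicator (fun t => |t| ^ (-(1 / 2) : ℝ)) q.1 *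
    (Set.Icc (-1 : ℝ) 1).indicator (fun t => |t| ^ (-(1 / 2) : ℝ)) q.2

lemma squareMajorant_nonneg (q : ℝ × ℝ) : 0 ≤ squareMajorant q :=
  mul_nonneg (Set.indicator_nonneg (fun _ _ => by positivity) _)
    (Set.indicator_nonneg (fun _ _ => by positivity) _)

lemma integrable_abs_rpow_neg_half_indicator :
    Integrable ((Set.Icc (-1 : ℝ) 1).indicator fun t => |t| ^ (-(1 / 2) : ℝ)) := by
  rw [integrable_indicator_iff measurableSet_Icc, ← Set.Icc_union_Icc_eq_Icc
    (b := 0) (by norm_num) (by norm_num)]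
  have h1 : IntegrableOn (fun t : ℝ => |t| ^ (-(1 / 2) : ℝ)) (Set.Icc 0 1) := by
    have := (intervalIntegral.intervalIntegrable_rpow' (a := 0) (b := 1)
      (r := -(1 / 2)) (by norm_num))
    rw [intervalIntegrable_iff_integrableOn_Icc_of_le (by norm_num)] at this
    refine this.congr_fun (fun t ht => ?_) measurableSet_Icc
    simp [abs_of_nonneg ht.1]
  refine IntegrableOn.union ?_ h1
  have h2 := (Measure.measurePreserving_neg (volume : Measure ℝ)).integrableOn_comp_preimage
    (MeasurableEquiv.neg ℝ).measurableEmbedding (f := fun t : ℝ => |t| ^ (-(1 / 2) : ℝ))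
    (s := Set.Icc 0 1)
  have h3 := h2.2 h1
  simpa [Function.comp_def] using h3

lemma integrable_squareMajorant : Integrable squareMajorant :=
  integrable_abs_rpow_neg_half_indicator.mul_prod integrable_abs_rpow_neg_half_indicator

/-- Both sides are homogeneous of degree `-1`. The factor `|q.1|` is what the mean value theorem
supplies, and a majorant in product form reduces integrability to one variable. -/
lemma abs_kernel_mul_le_squareMajorant {q : ℝ × ℝ} (h1 : |q.1| ≤ 1) (h2 : |q.2| ≤ 1) :
    |kernel q| * |q.1| ≤ squareMajorant q := by
  unfold squareMajorant
  rw [Set.indicator_of_mem (Set.mem_Icc.2 (abs_le.1 h1)),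
    Set.indicator_of_mem (Set.mem_Icc.2 (abs_le.1 h2))]
  unfold kernel
  rcases eq_or_ne q.1 0 with h | hq1
  · simp only [h]
    simp
  rcases eq_or_ne q.2 0 with h | hq2
  · simp only [h]
    simp
  have a1 := abs_pos.2 hq1
  have a2 := abs_pos.2 hq2
  rw [abs_div, abs_mul,
    abs_of_nonneg (show 0 ≤ 2 * Real.pi * (q.1 ^ 2 + q.2 ^ 2) ^ 2 by positivity),
    ← sq_abs q.1, ← sq_abs q.2, Real.rpow_neg a1.le, Real.rpow_neg a2.le,
    ← Real.sqrt_eq_rpow, ← Real.sqrt_eq_rpow]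
  generalize |q.1| = a at *
  generalize |q.2| = b at *
  -- Substituting `a = u²`, `b = v²` removes the square roots and leaves `u⁵ v³ ≤ (u⁴ + v⁴)²`, both
  -- sides of degree 8.
  obtain ⟨u, hu, rfl⟩ : ∃ u, 0 < u ∧ a = u ^ 2 :=
    ⟨√a, Real.sqrt_pos.2 a1, (Real.sq_sqrt a1.le).symm⟩
  obtain ⟨v, hv, rfl⟩ : ∃ v, 0 < v ∧ b = v ^ 2 :=
    ⟨√b, Real.sqrt_pos.2 a2, (Real.sq_sqrt a2.le).symm⟩
  rw [Real.sqrt_sq hu.le, Real.sqrt_sq hv.le, ← mul_inv, div_mul_eq_mul_div, inv_eq_one_div,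
    div_le_div_iff₀ (by positivity) (by positivity), one_mul]
  have hpi := Real.pi_gt_three
  have key : u ^ 5 * v ^ 3 ≤ ((u ^ 2) ^ 2 + (v ^ 2) ^ 2) ^ 2 := by
    have e1 : u * v ≤ u ^ 2 + v ^ 2 := by nlinarith [sq_nonneg (u - v), sq_nonneg u, sq_nonneg v]
    have e2 : u ^ 2 * v ^ 2 ≤ (u ^ 2) ^ 2 + (v ^ 2) ^ 2 := by
      nlinarith [sq_nonneg (u ^ 2 - v ^ 2), sq_nonneg (u ^ 2), sq_nonneg (v ^ 2)]
    have e3 : u ^ 3 * v ≤ (u ^ 2) ^ 2 + (v ^ 2) ^ 2 := by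
      have : u ^ 3 * v = u ^ 2 * (u * v) := by ring
      nlinarith [sq_nonneg (u - v), sq_nonneg (u ^ 2 - v ^ 2), sq_nonneg (v ^ 2),
        mul_nonneg (sq_nonneg u) (sq_nonneg (u - v))]
    calc u ^ 5 * v ^ 3 = (u ^ 3 * v) * (u ^ 2 * v ^ 2) := by ring
      _ ≤ ((u ^ 2) ^ 2 + (v ^ 2) ^ 2) * ((u ^ 2) ^ 2 + (v ^ 2) ^ 2) := by gcongr
      _ = _ := by ring
  calc u ^ 2 * v ^ 2 * u ^ 2 * (u * v) = u ^ 5 * v ^ 3 := by ring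
    _ ≤ ((u ^ 2) ^ 2 + (v ^ 2) ^ 2) ^ 2 := key
    _ ≤ _ := by nlinarith [sq_nonneg ((u ^ 2) ^ 2 + (v ^ 2) ^ 2)]

/-! ### Convergence of the principal value -/

/-- The complement of the Euclidean disc of radius `ε`. -/
def discCompl (ε : ℝ) : Set (ℝ × ℝ) := {q | ε < √(q.1 ^ 2 + q.2 ^ 2)}

lemma measurableSet_discCompl (ε : ℝ) : MeasurableSet (discCompl ε) :=
  measurableSet_lt measurable_const (by fun_prop)

lemma truncated_eq_setIntegral_discCompl (f : ℝ × ℝ → ℂ) (ε : ℝ) (p : ℝ × ℝ) :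
    truncated f ε p = ∫ q in discCompl ε, (kernel q : ℂ) * f (p - q) := by
  have hm : MeasurableSet {q : ℝ × ℝ | ε < √((p.1 - q.1) ^ 2 + (p.2 - q.2) ^ 2)} :=
    measurableSet_lt measurable_const (by fun_prop)
  unfold truncated
  rw [← integral_indicator hm, ← integral_indicator (measurableSet_discCompl ε),
    ← integral_sub_left_eq_self _ volume p]
  congr 1
  ext q
  simp only [Set.indicator, discCompl, Set.mem_ofPred_eq, Prod.fst_sub, Prod.snd_sub,
    sub_sub_cancel]
  rfl

/-- The integrand of the principal value, antisymmetrized in the first coordinate. -/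
def symmIntegrand (f : ℝ × ℝ → ℂ) (p q : ℝ × ℝ) : ℂ :=
  (kernel q : ℂ) * (f (p - q) - f (p - reflectFst q))

lemma integrableOn_kernel_mul (f : 𝓢(ℝ × ℝ, ℂ)) {ε : ℝ} (hε : 0 < ε) (p : ℝ × ℝ) :
    IntegrableOn (fun q => (kernel q : ℂ) * f (p - q)) (discCompl ε) := by
  have hf : Integrable (fun q => f (p - q)) := f.integrable.comp_sub_left p
  refine hf.integrableOn.bdd_mul (c := (ε ^ 2)⁻¹) (by fun_prop) ?_
  filter_upwards [ae_restrict_mem (measurableSet_discCompl ε)] with q hq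
  rw [Complex.norm_real, Real.norm_eq_abs]
  refine (abs_kernel_le q).trans ?_
  have : ε ^ 2 ≤ q.1 ^ 2 + q.2 ^ 2 := ((Real.lt_sqrt hε.le).1 hq).le
  gcongr

/-- The truncated region is invariant under the reflection and the kernel changes sign, so the
integral is the mean of its two reflected forms. The new integrand is integrable up to the origin.
-/
lemma truncated_eq_symm (f : 𝓢(ℝ × ℝ, ℂ)) {ε : ℝ} (hε : 0 < ε) (p : ℝ × ℝ) :
    truncated f ε p = (1 / 2 : ℂ) * ∫ q in discCompl ε, symmIntegrand f p q := by
  have hpre : reflectFst ⁻¹' discCompl ε = discCompl ε := by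
    ext q; simp [discCompl]
  have h1 := integrableOn_kernel_mul f hε p
  have h2 : IntegrableOn (fun q => (kernel q : ℂ) * f (p - reflectFst q)) (discCompl ε) := by
    have := (measurePreserving_reflectFst.integrableOn_comp_preimage
      reflectFst.measurableEmbedding).2 h1
    rw [hpre] at this
    convert this.neg using 2 with q
    simp [Function.comp_def, kernel_reflectFst, -reflectFst_apply]
  have h3 : ∫ q in discCompl ε, (kernel q : ℂ) * f (p - reflectFst q) =
      - ∫ q in discCompl ε, (kernel q : ℂ) * f (p - q) := by
    have := measurePreserving_reflectFst.setIntegral_preimage_emb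
      reflectFst.measurableEmbedding (fun q => (kernel q : ℂ) * f (p - q)) (discCompl ε)
    rw [hpre] at this
    rw [← this, ← integral_neg]
    simp [kernel_reflectFst, -reflectFst_apply]
  simp_rw [symmIntegrand, mul_sub]
  rw [integral_sub h1 h2, h3, truncated_eq_setIntegral_discCompl]
  ring

/-! ### Decay of Schwartz functions in terms of Cauchy weights -/

lemma inv_one_add_norm_pow_le (z : ℝ × ℝ) :
    ((1 + ‖z‖) ^ 6)⁻¹ ≤ cauchyWeight z.1 ^ 2 * cauchyWeight z.2 := by
  have aux : ∀ t : ℝ, |t| ≤ ‖z‖ → ((1 + ‖z‖) ^ 2)⁻¹ ≤ cauchyWeight t := fun t ht => by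
    unfold cauchyWeight
    gcongr
    nlinarith [sq_abs t, abs_nonneg t, norm_nonneg z]
  have h1 := aux z.1 (norm_fst_le z)
  have h2 := aux z.2 (norm_snd_le z)
  calc ((1 + ‖z‖) ^ 6)⁻¹ = (((1 + ‖z‖) ^ 2)⁻¹) ^ 2 * ((1 + ‖z‖) ^ 2)⁻¹ := by
        rw [← inv_pow, ← inv_pow]; ring
    _ ≤ _ := by gcongr

/-- The weight in `z.1` is squared because one factor is spent on Peetre's inequality, to extract
decay in `p.1`, and the other must remain integrable. The derivative is used only near `p`, where
one factor suffices. -/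
lemma exists_schwartz_bound (f : 𝓢(ℝ × ℝ, ℂ)) : ∃ C : ℝ, 0 ≤ C ∧
    (∀ z, ‖f z‖ ≤ C * (cauchyWeight z.1 ^ 2 * cauchyWeight z.2)) ∧
    ∀ z, ‖fderiv ℝ f z‖ ≤ C * cauchyWeight z.1 := by
  set C := 2 ^ 6 * (Finset.Iic (6, 1)).sup (fun m => SchwartzMap.seminorm ℝ m.1 m.2) f with hC
  have hC0 : 0 ≤ C := by positivity
  have key : ∀ n ≤ 1, ∀ z, ‖iteratedFDeriv ℝ n f z‖ ≤
      C * (cauchyWeight z.1 ^ 2 * cauchyWeight z.2) := fun n hn z => by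
    have h := SchwartzMap.one_add_le_sup_seminorm_apply (𝕜 := ℝ) (m := (6, 1)) (k := 6) (n := n)
      le_rfl hn f z
    have hpos : 0 < (1 + ‖z‖) ^ 6 := by positivity
    calc ‖iteratedFDeriv ℝ n f z‖ ≤ C * ((1 + ‖z‖) ^ 6)⁻¹ := by
          rw [← div_eq_mul_inv, le_div_iff₀ hpos, mul_comm]; exact h
      _ ≤ _ := by gcongr; exact inv_one_add_norm_pow_le z
  have hle : ∀ t, cauchyWeight t ≤ 1 := fun t => by
    unfold cauchyWeight
    exact inv_le_one_of_one_le₀ (by nlinarith [sq_nonneg t])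
  refine ⟨C, hC0, fun z => by simpa using key 0 (by simp) z, fun z => ?_⟩
  have h := key 1 le_rfl z
  rw [norm_iteratedFDeriv_one] at h
  refine h.trans ?_
  gcongr
  have a := cauchyWeight_pos z.1
  have b := cauchyWeight_pos z.2
  calc cauchyWeight z.1 ^ 2 * cauchyWeight z.2 ≤ cauchyWeight z.1 ^ 2 * 1 := by
        gcongr; exact hle _
    _ ≤ cauchyWeight z.1 := by nlinarith [hle z.1]

/-- An integrable majorant of `symmIntegrand f p`, up to a multiple of `cauchyWeight p.1`. -/
def symmMajorant (p q : ℝ × ℝ) : ℝ :=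
  squareMajorant q + (cauchyWeight (p.1 - q.1) * cauchyWeight (p.2 - q.2) +
    cauchyWeight (p.1 + q.1) * cauchyWeight (p.2 - q.2))

lemma integrable_symmMajorant (p : ℝ × ℝ) : Integrable (symmMajorant p) := by
  have h1 := integrable_cauchyWeight.comp_sub_left p.1
  have h2 := integrable_cauchyWeight.comp_sub_left p.2
  have h3 := integrable_cauchyWeight.comp_add_left p.1
  exact integrable_squareMajorant.add ((h1.mul_prod h2).add (h3.mul_prod h2))

/-- The value does not depend on `p`, which makes the decay of the transform uniform in `y`. -/
lemma integral_symmMajorant (p : ℝ × ℝ) :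
    ∫ q, symmMajorant p q = (∫ q, squareMajorant q) + 2 * (∫ t, cauchyWeight t) ^ 2 := by
  have h1 := integrable_cauchyWeight.comp_sub_left p.1
  have h2 := integrable_cauchyWeight.comp_sub_left p.2
  have h3 := integrable_cauchyWeight.comp_add_left p.1
  have i1 : ∫ q : ℝ × ℝ, cauchyWeight (p.1 - q.1) * cauchyWeight (p.2 - q.2) =
      (∫ t, cauchyWeight t) ^ 2 := by
    rw [Measure.volume_eq_prod, integral_prod_mul (fun t => cauchyWeight (p.1 - t))
      (fun t => cauchyWeight (p.2 - t)), integral_sub_left_eq_self, integral_sub_left_eq_self, sq]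
  have i2 : ∫ q : ℝ × ℝ, cauchyWeight (p.1 + q.1) * cauchyWeight (p.2 - q.2) =
      (∫ t, cauchyWeight t) ^ 2 := by
    rw [Measure.volume_eq_prod, integral_prod_mul (fun t => cauchyWeight (p.1 + t))
      (fun t => cauchyWeight (p.2 - t)), integral_add_left_eq_self, integral_sub_left_eq_self, sq]
  have h4 := integral_add (h1.mul_prod h2) (h3.mul_prod h2)
  have h5 := integral_add integrable_squareMajorant ((h1.mul_prod h2).add (h3.mul_prod h2))
  simp only [Pi.add_apply, ← Measure.volume_eq_prod] at h4 h5
  simp_rw [symmMajorant]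
  rw [h5, h4, i1, i2]
  ring

lemma exists_norm_symmIntegrand_le (f : 𝓢(ℝ × ℝ, ℂ)) : ∃ C : ℝ, 0 ≤ C ∧
    ∀ p q, ‖symmIntegrand f p q‖ ≤ C * cauchyWeight p.1 * symmMajorant p q := by
  obtain ⟨C, hC, hf, hf'⟩ := exists_schwartz_bound f
  -- Near the origin, 4 from comparing weights at distance at most 1 and 2 from the distance
  -- `2|q.1|` between the reflected points; the far part needs only `4 * C`.
  refine ⟨8 * C, by positivity, fun p q => ?_⟩
  have w0 := cauchyWeight_pos p.1
  have w1 := cauchyWeight_pos (p.1 - q.1)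
  have w2 := cauchyWeight_pos (p.2 - q.2)
  have w3 := cauchyWeight_pos (p.1 + q.1)
  have hsq := squareMajorant_nonneg q
  rw [symmIntegrand, norm_mul, Complex.norm_real, Real.norm_eq_abs, symmMajorant]
  by_cases hq : |q.1| ≤ 1 ∧ |q.2| ≤ 1
  -- The mean value theorem is applied on a vertical strip of half-width 1 about `p.1`, which
  -- contains both reflected points and on which the weight is comparable to its value at `p.1`.
  · have hconv : Convex ℝ {z : ℝ × ℝ | |z.1 - p.1| ≤ 1} := by
      have : {z : ℝ × ℝ | |z.1 - p.1| ≤ 1} = Prod.fst ⁻¹' Set.Icc (p.1 - 1) (p.1 + 1) := by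
        ext z
        simp only [Set.mem_ofPred_eq, Set.mem_preimage, Set.mem_Icc, abs_le]
        constructor <;> rintro ⟨h, h'⟩ <;> constructor <;> linarith
      rw [this]
      exact (convex_Icc _ _).is_linear_preimage (LinearMap.fst ℝ ℝ ℝ).isLinear
    have hdiff : ‖f (p - q) - f (p - reflectFst q)‖ ≤ 4 * C * cauchyWeight p.1 *
        ‖(p - q) - (p - reflectFst q)‖ := by
      refine hconv.norm_image_sub_le_of_norm_fderiv_le (𝕜 := ℝ) (fun z _ => f.differentiableAt)
        (fun z hz => ?_) ?_ ?_
      · calc ‖fderiv ℝ f z‖ ≤ C * cauchyWeight z.1 := hf' z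
          _ ≤ C * (4 * cauchyWeight p.1) := by
              gcongr; exact cauchyWeight_le_of_abs_le_one hz
          _ = _ := by ring
      · simpa using hq.1
      · simpa using hq.1
    have hnorm : ‖(p - q) - (p - reflectFst q)‖ = 2 * |q.1| := by
      have : (p - q) - (p - reflectFst q) = (-(2 * q.1), 0) := by
        ext
        · simp; ring
        · simp
      rw [this, Prod.norm_def]
      simp
    rw [hnorm] at hdiff
    calc |kernel q| * ‖f (p - q) - f (p - reflectFst q)‖
        ≤ |kernel q| * (4 * C * cauchyWeight p.1 * (2 * |q.1|)) := by gcongr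
      _ = 8 * C * cauchyWeight p.1 * (|kernel q| * |q.1|) := by ring
      _ ≤ 8 * C * cauchyWeight p.1 * squareMajorant q := by
          gcongr; exact abs_kernel_mul_le_squareMajorant hq.1 hq.2
      _ ≤ _ := by
          gcongr
          have := mul_pos w1 w2
          have := mul_pos w3 w2
          linarith
  · have hr : 1 ≤ q.1 ^ 2 + q.2 ^ 2 := by
      by_contra! h
      refine hq ⟨?_, ?_⟩
      · rw [← sq_le_one_iff_abs_le_one]; nlinarith [sq_nonneg q.2]
      · rw [← sq_le_one_iff_abs_le_one]; nlinarith [sq_nonneg q.1]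
    have hk := abs_kernel_le_cauchyWeight hr
    have b1 : cauchyWeight q.1 * ‖f (p - q)‖ ≤
        2 * C * cauchyWeight p.1 * (cauchyWeight (p.1 - q.1) * cauchyWeight (p.2 - q.2)) := by
      calc cauchyWeight q.1 * ‖f (p - q)‖ ≤ cauchyWeight q.1 *
            (C * (cauchyWeight (p.1 - q.1) ^ 2 * cauchyWeight (p.2 - q.2))) := by
            gcongr
            · exact (cauchyWeight_pos _).le
            · exact hf (p - q)
        _ = C * (cauchyWeight q.1 * cauchyWeight (p.1 - q.1)) *
            (cauchyWeight (p.1 - q.1) * cauchyWeight (p.2 - q.2)) := by ring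
        _ ≤ C * (2 * cauchyWeight p.1) *
            (cauchyWeight (p.1 - q.1) * cauchyWeight (p.2 - q.2)) := by
            gcongr ?_ * _
            exact mul_le_mul_of_nonneg_left (cauchyWeight_mul_le _ _) hC
        _ = _ := by ring
    have b2 : cauchyWeight q.1 * ‖f (p - reflectFst q)‖ ≤
        2 * C * cauchyWeight p.1 * (cauchyWeight (p.1 + q.1) * cauchyWeight (p.2 - q.2)) := by
      have hz : p - reflectFst q = (p.1 + q.1, p.2 - q.2) := by ext <;> simp
      have hP := cauchyWeight_mul_le p.1 (-q.1)
      rw [cauchyWeight_neg, sub_neg_eq_add] at hP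
      calc cauchyWeight q.1 * ‖f (p - reflectFst q)‖ ≤ cauchyWeight q.1 *
            (C * (cauchyWeight (p.1 + q.1) ^ 2 * cauchyWeight (p.2 - q.2))) := by
            gcongr
            · exact (cauchyWeight_pos _).le
            · rw [hz]; exact hf _
        _ = C * (cauchyWeight q.1 * cauchyWeight (p.1 + q.1)) *
            (cauchyWeight (p.1 + q.1) * cauchyWeight (p.2 - q.2)) := by ring
        _ ≤ C * (2 * cauchyWeight p.1) *
            (cauchyWeight (p.1 + q.1) * cauchyWeight (p.2 - q.2)) := by gcongr
        _ = _ := by ring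
    calc |kernel q| * ‖f (p - q) - f (p - reflectFst q)‖
        ≤ (2 * cauchyWeight q.1) * (‖f (p - q)‖ + ‖f (p - reflectFst q)‖) := by
          gcongr
          · exact (abs_nonneg _).trans hk
          · exact norm_sub_le _ _
      _ = 2 * (cauchyWeight q.1 * ‖f (p - q)‖ + cauchyWeight q.1 * ‖f (p - reflectFst q)‖) := by
          ring
      _ ≤ 2 * (2 * C * cauchyWeight p.1 * (cauchyWeight (p.1 - q.1) * cauchyWeight (p.2 - q.2)) +
          2 * C * cauchyWeight p.1 * (cauchyWeight (p.1 + q.1) * cauchyWeight (p.2 - q.2))) := by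
          gcongr
      _ ≤ _ := by
          have e : 0 ≤ C * cauchyWeight p.1 := by positivity
          have := mul_nonneg e hsq
          have := mul_nonneg e (mul_pos w1 w2).le
          have := mul_nonneg e (mul_pos w3 w2).le
          nlinarith

lemma integrable_symmIntegrand (f : 𝓢(ℝ × ℝ, ℂ)) (p : ℝ × ℝ) :
    Integrable (symmIntegrand f p) := by
  obtain ⟨C, -, hC⟩ := exists_norm_symmIntegrand_le f
  refine ((integrable_symmMajorant p).const_mul (C * cauchyWeight p.1)).mono' ?_
    (.of_forall (hC p))
  have : Measurable (symmIntegrand f p) := by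
    have h1 : Measurable (f : ℝ × ℝ → ℂ) := f.continuous.measurable
    unfold symmIntegrand
    fun_prop
  exact this.aestronglyMeasurable

/-- The principal value converges for Schwartz functions. -/
theorem tendsto_truncated_symm (f : 𝓢(ℝ × ℝ, ℂ)) (p : ℝ × ℝ) :
    Tendsto (fun ε => truncated f ε p) (𝓝[>] 0)
      (𝓝 ((1 / 2 : ℂ) * ∫ q, symmIntegrand f p q)) := by
  have hint := integrable_symmIntegrand f p
  have h : Tendsto (fun ε => ∫ q, (discCompl ε).indicator (symmIntegrand f p) q) (𝓝[>] 0)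
      (𝓝 (∫ q, symmIntegrand f p q)) := by
    refine tendsto_integral_filter_of_dominated_convergence (fun q => ‖symmIntegrand f p q‖)
      (.of_forall fun ε => hint.aestronglyMeasurable.indicator (measurableSet_discCompl ε))
      (.of_forall fun ε => .of_forall fun q => norm_indicator_le_norm_self _ _)
      hint.norm (.of_forall fun q => ?_)
    -- For `q ≠ 0` the indicator is 1 once `ε < |q|`; at `q = 0` the integrand vanishes.
    refine tendsto_const_nhds.congr' ?_
    rcases eq_or_ne q 0 with rfl | hq
    · refine .of_forall fun ε => ?_
      have : symmIntegrand f p 0 = 0 := by simp [symmIntegrand]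
      simp [Set.indicator, this]
    · have hpos : 0 < √(q.1 ^ 2 + q.2 ^ 2) := by
        apply Real.sqrt_pos.2
        by_contra! h
        apply hq
        ext
        · simpa using pow_eq_zero_iff (two_ne_zero) |>.1
            (by nlinarith [sq_nonneg q.1, sq_nonneg q.2] : q.1 ^ 2 = 0)
        · simpa using pow_eq_zero_iff (two_ne_zero) |>.1
            (by nlinarith [sq_nonneg q.1, sq_nonneg q.2] : q.2 ^ 2 = 0)
      filter_upwards [Ioo_mem_nhdsGT hpos] with ε hε
      rw [Set.indicator_of_mem (show q ∈ discCompl ε from hε.2)]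
  refine (h.const_mul (1 / 2 : ℂ)).congr' ?_
  filter_upwards [self_mem_nhdsWithin] with ε hε
  rw [truncated_eq_symm f hε p, integral_indicator (measurableSet_discCompl ε)]

lemma R₁₂_eq_symm (f : 𝓢(ℝ × ℝ, ℂ)) (p : ℝ × ℝ) :
    R₁₂ f p = (1 / 2 : ℂ) * ∫ q, symmIntegrand f p q :=
  (tendsto_truncated_symm f p).limUnder_eq

theorem tendsto_truncated (f : 𝓢(ℝ × ℝ, ℂ)) (p : ℝ × ℝ) :
    Tendsto (fun ε => truncated f ε p) (𝓝[>] 0) (𝓝 (R₁₂ f p)) := by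
  rw [R₁₂_eq_symm]
  exact tendsto_truncated_symm f p

/-- The double Riesz transform of a Schwartz function decays in `x`, uniformly in `y`. -/
theorem exists_norm_R₁₂_le (f : 𝓢(ℝ × ℝ, ℂ)) :
    ∃ C : ℝ, ∀ p, ‖R₁₂ f p‖ ≤ C * cauchyWeight p.1 := by
  obtain ⟨C, -, hC⟩ := exists_norm_symmIntegrand_le f
  refine ⟨1 / 2 * (C * ((∫ q, squareMajorant q) + 2 * (∫ t, cauchyWeight t) ^ 2)), fun p => ?_⟩
  have h := norm_integral_le_of_norm_le ((integrable_symmMajorant p).const_mul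
    (C * cauchyWeight p.1)) (.of_forall (hC p))
  rw [integral_const_mul, integral_symmMajorant] at h
  rw [R₁₂_eq_symm, norm_mul]
  have h2 : ‖(1 / 2 : ℂ)‖ = 1 / 2 := by norm_num
  rw [h2]
  linarith

/-- A family of functions dominated by a multiple of a square integrable function has finite
mixed norm. -/
lemma normXthenY_two_top_lt_top {F : ℝ × ℝ → ℂ} {C : ℝ}
    (hF : ∀ p, ‖F p‖ ≤ C * cauchyWeight p.1) : normXthenY 2 ∞ F < ∞ := by
  have hmem : MemLp (fun x => C * cauchyWeight x) 2 volume := by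
    have hc : Continuous cauchyWeight := by
      unfold cauchyWeight
      exact Continuous.inv₀ (by fun_prop) fun t => by positivity
    refine MemLp.const_mul ?_ C
    rw [memLp_two_iff_integrable_sq hc.aestronglyMeasurable]
    refine integrable_cauchyWeight.mono' (by fun_prop) (.of_forall fun t => ?_)
    have h0 := cauchyWeight_pos t
    have h1 : cauchyWeight t ≤ 1 := by
      unfold cauchyWeight
      exact inv_le_one_of_one_le₀ (by nlinarith [sq_nonneg t])
    rw [Real.norm_eq_abs, abs_of_nonneg (by positivity)]
    nlinarith
  refine lt_of_le_of_lt ?_ hmem.2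
  unfold normXthenY
  rw [eLpNorm_exponent_top]
  refine eLpNormEssSup_le_of_ae_enorm_bound (.of_forall fun y => ?_)
  rw [enorm_eq_self]
  exact eLpNorm_mono_real fun x => hF (x, y)

/-! ### Schwartz functions: tensor products and Gaussian factors -/

lemma norm_iteratedFDeriv_comp_le_of_norm_le_one {E : Type*} [NormedAddCommGroup E]
    [NormedSpace ℝ E] (L : E →L[ℝ] ℝ) (hL : ‖L‖ ≤ 1) (f : 𝓢(ℝ, ℂ)) (i : ℕ) (z : E) :
    ‖iteratedFDeriv ℝ i (fun z => f (L z)) z‖ ≤ ‖iteratedFDeriv ℝ i f (L z)‖ := by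
  have h := L.iteratedFDeriv_comp_right (f.smooth ⊤) z (i := i) (mod_cast le_top)
  have h' := (iteratedFDeriv ℝ i f (L z)).norm_compContinuousLinearMap_le fun _ => L
  rw [Function.comp_def] at h
  rw [h]
  refine h'.trans (mul_le_of_le_one_right (norm_nonneg _) ?_)
  exact Finset.prod_le_one (fun _ _ => norm_nonneg _) fun _ _ => hL

/-- The tensor product `(x, y) ↦ f(x) g(y)` of two Schwartz functions of one variable. -/
def schwartzTensor (f g : 𝓢(ℝ, ℂ)) : 𝓢(ℝ × ℝ, ℂ) where
  toFun z := f z.1 * g z.2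
  smooth' := ((f.smooth ⊤).comp contDiff_fst).mul ((g.smooth ⊤).comp contDiff_snd)
  decay' k n := by
    choose Cf hf using fun k n => f.decay k n
    choose Cg hg using fun k n => g.decay k n
    refine ⟨∑ i ∈ Finset.range (n + 1), (n.choose i : ℝ) *
      (Cf k i * Cg 0 (n - i) + Cf 0 i * Cg k (n - i)), fun z => ?_⟩
    have h := norm_iteratedFDeriv_mul_le (𝕜 := ℝ) (f := fun z : ℝ × ℝ => f z.1)
      (g := fun z : ℝ × ℝ => g z.2) (N := (⊤ : ℕ∞)) ((f.smooth ⊤).comp contDiff_fst)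
      ((g.smooth ⊤).comp contDiff_snd) z (n := n) (mod_cast le_top)
    calc ‖z‖ ^ k * ‖iteratedFDeriv ℝ n (fun z : ℝ × ℝ => f z.1 * g z.2) z‖
        ≤ ‖z‖ ^ k * _ := mul_le_mul_of_nonneg_left h (by positivity)
      _ = ∑ i ∈ Finset.range (n + 1), (n.choose i : ℝ) * (‖z‖ ^ k *
          (‖iteratedFDeriv ℝ i (fun z : ℝ × ℝ => f z.1) z‖ *
            ‖iteratedFDeriv ℝ (n - i) (fun z : ℝ × ℝ => g z.2) z‖)) := by
          rw [Finset.mul_sum]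
          exact Finset.sum_congr rfl fun i _ => by ring
      _ ≤ _ := by
          refine Finset.sum_le_sum fun i _ => mul_le_mul_of_nonneg_left ?_ (by positivity)
          have e1 := norm_iteratedFDeriv_comp_le_of_norm_le_one (ContinuousLinearMap.fst ℝ ℝ ℝ)
            (ContinuousLinearMap.norm_fst_le ..) f i z
          have e2 := norm_iteratedFDeriv_comp_le_of_norm_le_one (ContinuousLinearMap.snd ℝ ℝ ℝ)
            (ContinuousLinearMap.norm_snd_le ..) g (n - i) z
          simp only [ContinuousLinearMap.coe_fst', ContinuousLinearMap.coe_snd'] at e1 e2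
          have e3 : ‖z‖ ^ k ≤ ‖z.1‖ ^ k + ‖z.2‖ ^ k := by
            rcases max_choice ‖z.1‖ ‖z.2‖ with h | h <;> rw [Prod.norm_def, h]
            · exact le_add_of_nonneg_right (by positivity)
            · exact le_add_of_nonneg_left (by positivity)
          have f0 := (hf 0 i).2 z.1
          have fk := (hf k i).2 z.1
          have g0 := (hg 0 (n - i)).2 z.2
          have gk := (hg k (n - i)).2 z.2
          rw [pow_zero, one_mul] at f0 g0
          calc _ ≤ (‖z.1‖ ^ k + ‖z.2‖ ^ k) *
                (‖iteratedFDeriv ℝ i f z.1‖ * ‖iteratedFDeriv ℝ (n - i) g z.2‖) := by gcongr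
            _ = (‖z.1‖ ^ k * ‖iteratedFDeriv ℝ i f z.1‖) * ‖iteratedFDeriv ℝ (n - i) g z.2‖ +
                ‖iteratedFDeriv ℝ i f z.1‖ * (‖z.2‖ ^ k * ‖iteratedFDeriv ℝ (n - i) g z.2‖) := by
                ring
            _ ≤ _ := by
                have := (norm_nonneg _).trans f0
                have : 0 ≤ Cf k i := le_trans (by positivity) fk
                gcongr

@[simp] lemma schwartzTensor_apply (f g : 𝓢(ℝ, ℂ)) (z : ℝ × ℝ) :
    schwartzTensor f g z = f z.1 * g z.2 := rfl

/-- The derivatives of `exp (-t)` are bounded only on half-lines bounded below, so the composition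
with `x²` goes through the open half-line `t > -1`, where the bound is `e`. -/
lemma hasTemperateGrowth_exp_neg_sq :
    (fun x : ℝ => Real.exp (-x ^ 2)).HasTemperateGrowth := by
  have hopen : IsOpen (Set.Ioi (-1 : ℝ)) := isOpen_Ioi
  have hsmooth : ContDiff ℝ (⊤ : ℕ∞) fun t : ℝ => Real.exp (-t) := by fun_prop
  refine Function.HasTemperateGrowth.comp' (g := fun t => Real.exp (-t)) (f := fun x : ℝ => x ^ 2)
    (t := Set.Ioi (-1)) ?_ hopen.uniqueDiffOn hsmooth.contDiffOn ?_ (by fun_prop)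
  · rintro - ⟨x, rfl⟩
    simp only [Set.mem_Ioi]
    nlinarith [sq_nonneg x]
  · refine fun N => ⟨0, Real.exp 1, by positivity, fun n _ x hx => ?_⟩
    rw [iteratedFDerivWithin_of_isOpen n hopen hx, norm_iteratedFDeriv_eq_norm_iteratedDeriv]
    have : iteratedDeriv n (fun t : ℝ => Real.exp (-t)) x = (-1) ^ n * Real.exp (-x) := by
      rw [iteratedDeriv_comp_neg n Real.exp x, iteratedDeriv_eq_iterate, Real.iter_deriv_exp,
        smul_eq_mul]
    rw [this, pow_zero, mul_one, norm_mul, norm_pow, norm_neg, norm_one, one_pow, one_mul,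
      Real.norm_eq_abs, Real.abs_exp]
    exact Real.exp_le_exp.2 (by linarith [Set.mem_Ioi.1 hx])

/-! ### The inverse Fourier transform of a frequency cutoff -/

lemma exists_schwartz_invFourier {φ : ℝ → ℝ} (hφ : ContDiff ℝ (⊤ : ℕ∞) φ)
    (hc : HasCompactSupport φ) :
    ∃ f : 𝓢(ℝ, ℂ), ∀ x, f x = invFourier φ x := by
  have hc' : HasCompactSupport fun ξ => (φ ξ : ℂ) := hc.comp_left Complex.ofReal_zero
  have hs' : ContDiff ℝ (⊤ : ℕ∞) fun ξ => (φ ξ : ℂ) := Complex.ofRealCLM.contDiff.comp hφ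
  let u : 𝓢(ℝ, ℂ) := hc'.toSchwartzMap hs'
  have hpi : (2 * Real.pi) ≠ 0 := by positivity
  -- Dilation by `1/(2π)` converts the phase `2πxξ` of Mathlib's transform to `xξ`.
  let L : ℝ ≃L[ℝ] ℝ :=
    ContinuousLinearEquiv.unitsEquivAut ℝ (Units.mk0 (2 * Real.pi)⁻¹ (by positivity))
  let v : 𝓢(ℝ, ℂ) :=
    SchwartzMap.compCLMOfContinuousLinearEquiv ℂ L (FourierTransformInv.fourierInv u)
  refine ⟨(((Real.sqrt (2 * Real.pi))⁻¹ : ℝ) : ℂ) • v, fun x => ?_⟩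
  have hv : v x = ∫ ξ : ℝ, Complex.exp (Complex.I * (x : ℂ) * (ξ : ℂ)) * (φ ξ : ℂ) := by
    have h1 : v x = (FourierTransformInv.fourierInv u : 𝓢(ℝ, ℂ)) (L x) := rfl
    rw [h1, SchwartzMap.fourierInv_coe, Real.fourierInv_eq']
    refine integral_congr_ae (.of_forall fun ξ => ?_)
    have h2 : L x = x * (2 * Real.pi)⁻¹ := rfl
    simp only [h2, smul_eq_mul]
    have h3 : u ξ = (φ ξ : ℂ) := rfl
    rw [h3]
    congr 2
    simp
    field_simp
  simp only [smul_apply, smul_eq_mul, hv, invFourier]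

lemma exists_schwartz_tensorBump {χ ψ : ℝ → ℝ} (hχ : ContDiff ℝ (⊤ : ℕ∞) χ)
    (hχc : HasCompactSupport χ) (hψ : ContDiff ℝ (⊤ : ℕ∞) ψ) (hψc : HasCompactSupport ψ) (j : ℕ) :
    ∃ G : 𝓢(ℝ × ℝ, ℂ), ∀ p, G p = tensorBump χ ψ j p := by
  have hs : ContDiff ℝ (⊤ : ℕ∞) (freqCutoff χ j) := by
    unfold freqCutoff
    fun_prop
  have hc : HasCompactSupport (freqCutoff χ j) := by
    have h1 : HasCompactSupport fun ξ : ℝ => χ (ξ - 2 ^ j) :=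
      hχc.comp_homeomorph (Homeomorph.subRight ((2 : ℝ) ^ j))
    have h2 : HasCompactSupport fun ξ : ℝ => χ (-ξ - 2 ^ j) :=
      hχc.comp_homeomorph ((Homeomorph.neg ℝ).trans (Homeomorph.subRight ((2 : ℝ) ^ j)))
    exact h1.add h2
  obtain ⟨f, hf⟩ := exists_schwartz_invFourier hs hc
  have hψ' : HasCompactSupport fun y => (ψ y : ℂ) := hψc.comp_left Complex.ofReal_zero
  let w : 𝓢(ℝ, ℂ) := hψ'.toSchwartzMap (Complex.ofRealCLM.contDiff.comp hψ)
  have hg : (fun x : ℝ => (Real.exp (-x ^ 2) : ℂ)).HasTemperateGrowth :=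
    Function.Complex.hasTemperateGrowth_ofReal.comp hasTemperateGrowth_exp_neg_sq
  refine ⟨schwartzTensor (SchwartzMap.smulLeftCLM ℂ
    (fun x : ℝ => (Real.exp (-x ^ 2) : ℂ)) f) w, fun p => ?_⟩
  rw [schwartzTensor_apply, SchwartzMap.smulLeftCLM_apply_apply hg, hf, smul_eq_mul, tensorBump]
  have : w p.2 = (ψ p.2 : ℂ) := rfl
  rw [this]
  ring

/-! ### The profile of a tensor bump -/

/-- The real profile `e^{-x²} (2π)^{-1/2} ∫ 2 cos(x ξ) χ(ξ - 2^j) dξ` of a tensor bump. -/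
def profile (χ : ℝ → ℝ) (j : ℕ) (x : ℝ) : ℝ :=
  Real.exp (-x ^ 2) * ((√(2 * Real.pi))⁻¹ * ∫ ξ, 2 * Real.cos (x * ξ) * χ (ξ - 2 ^ j))

/-- The reflected half of the cutoff contributes the conjugate exponential, and the two add up to a
real cosine. -/
lemma invFourier_freqCutoff {χ : ℝ → ℝ} (hχ : Integrable χ) (j : ℕ) (x : ℝ) :
    invFourier (freqCutoff χ j) x =
      (((√(2 * Real.pi))⁻¹ * ∫ ξ, 2 * Real.cos (x * ξ) * χ (ξ - 2 ^ j) : ℝ) : ℂ) := by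
  have h0 : Integrable fun ξ : ℝ => (χ (ξ - 2 ^ j) : ℂ) := (hχ.comp_sub_right _).ofReal
  have hexp : ∀ c : ℝ, Integrable fun ξ : ℝ =>
      Complex.exp (Complex.I * (x : ℂ) * ((c * ξ : ℝ) : ℂ)) * (χ (ξ - 2 ^ j) : ℂ) := fun c => by
    refine h0.bdd_mul (c := 1) (by fun_prop) (.of_forall fun ξ => ?_)
    rw [mul_assoc, ← Complex.ofReal_mul, mul_comm, Complex.norm_exp_ofReal_mul_I]
  have h1 := hexp 1
  have h2 := hexp (-1)
  simp only [one_mul, neg_one_mul] at h1 h2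
  have hneg : ∫ ξ : ℝ, Complex.exp (Complex.I * (x : ℂ) * (ξ : ℂ)) * (χ (-ξ - 2 ^ j) : ℂ) =
      ∫ ξ : ℝ, Complex.exp (Complex.I * (x : ℂ) * ((-ξ : ℝ) : ℂ)) * (χ (ξ - 2 ^ j) : ℂ) := by
    rw [← integral_neg_eq_self]
    simp
  have h3 : Integrable fun ξ : ℝ =>
      Complex.exp (Complex.I * (x : ℂ) * (ξ : ℂ)) * (χ (-ξ - 2 ^ j) : ℂ) := by
    simpa using h2.comp_neg
  unfold invFourier
  rw [Complex.ofReal_mul, ← integral_complex_ofReal]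
  congr 1
  calc ∫ ξ : ℝ, Complex.exp (Complex.I * (x : ℂ) * (ξ : ℂ)) * (freqCutoff χ j ξ : ℂ)
      = ∫ ξ : ℝ, (Complex.exp (Complex.I * (x : ℂ) * (ξ : ℂ)) * (χ (ξ - 2 ^ j) : ℂ) +
          Complex.exp (Complex.I * (x : ℂ) * (ξ : ℂ)) * (χ (-ξ - 2 ^ j) : ℂ)) := by
        simp only [freqCutoff, Complex.ofReal_add, mul_add]
    _ = (∫ ξ : ℝ, Complex.exp (Complex.I * (x : ℂ) * (ξ : ℂ)) * (χ (ξ - 2 ^ j) : ℂ)) +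
          ∫ ξ : ℝ, Complex.exp (Complex.I * (x : ℂ) * ((-ξ : ℝ) : ℂ)) * (χ (ξ - 2 ^ j) : ℂ) := by
        rw [integral_add h1 h3, hneg]
    _ = _ := by
        rw [← integral_add h1 h2]
        refine integral_congr_ae (.of_forall fun ξ => ?_)
        simp only [Complex.ofReal_mul, Complex.ofReal_cos, Complex.ofReal_ofNat]
        rw [Complex.two_cos]
        push_cast
        rw [← add_mul]
        congr 3 <;> ring_nf

lemma tensorBump_eq {χ : ℝ → ℝ} (hχ : Integrable χ) (ψ : ℝ → ℝ) (j : ℕ) (p : ℝ × ℝ) :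
    tensorBump χ ψ j p = ((ψ p.2 * profile χ j p.1 : ℝ) : ℂ) := by
  rw [tensorBump, invFourier_freqCutoff hχ, profile]
  push_cast
  ring

/-- The constant is independent of `j` because translating `χ` does not change its integral. -/
lemma abs_profile_le {χ : ℝ → ℝ} (hχ : Integrable χ) (h0 : ∀ t, 0 ≤ χ t) (j : ℕ) (x : ℝ) :
    |profile χ j x| ≤ ((√(2 * Real.pi))⁻¹ * (2 * ∫ ξ, χ ξ)) * Real.exp (-x ^ 2) := by
  rw [profile, abs_mul, Real.abs_exp, abs_mul,
    abs_of_nonneg (by positivity : 0 ≤ (√(2 * Real.pi))⁻¹),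
    mul_comm]
  gcongr
  rw [← integral_sub_right_eq_self χ ((2 : ℝ) ^ j), ← integral_const_mul, ← Real.norm_eq_abs]
  refine norm_integral_le_of_norm_le ((hχ.comp_sub_right _).const_mul 2) (.of_forall fun ξ => ?_)
  rw [Real.norm_eq_abs, abs_mul, abs_mul, abs_of_nonneg (h0 _)]
  have := Real.abs_cos_le_one (x * ξ)
  have := h0 (ξ - 2 ^ j)
  gcongr
  rw [abs_of_pos two_pos]
  linarith

lemma profile_neg (χ : ℝ → ℝ) (j : ℕ) (x : ℝ) : profile χ j (-x) = profile χ j x := by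
  simp [profile]

lemma continuous_profile {χ : ℝ → ℝ} (hχ : Integrable χ) (j : ℕ) :
    Continuous (profile χ j) := by
  unfold profile
  refine Continuous.mul (by fun_prop) (Continuous.mul continuous_const ?_)
  have hi : Integrable fun ξ => χ (ξ - 2 ^ j) := hχ.comp_sub_right _
  refine continuous_of_dominated (bound := fun ξ => 2 * ‖χ (ξ - 2 ^ j)‖)
    (fun x => AEStronglyMeasurable.mul (by fun_prop) hi.aestronglyMeasurable)
    (fun x => .of_forall fun ξ => ?_) (hi.norm.const_mul 2) (.of_forall fun ξ => by fun_prop)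
  rw [norm_mul, norm_mul, Real.norm_eq_abs (Real.cos _)]
  have := Real.abs_cos_le_one (x * ξ)
  gcongr
  rw [Real.norm_eq_abs, abs_of_pos two_pos]
  linarith

lemma integrable_exp_neg_sq : Integrable fun x : ℝ => Real.exp (-x ^ 2) := by
  simpa using integrable_exp_neg_mul_sq (b := 1) one_pos

lemma integrable_profile {χ : ℝ → ℝ} (hχ : Integrable χ) (h0 : ∀ t, 0 ≤ χ t) (j : ℕ) :
    Integrable (profile χ j) :=
  (integrable_exp_neg_sq.const_mul _).mono' (continuous_profile hχ j).aestronglyMeasurable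
    (.of_forall fun x => abs_profile_le hχ h0 j x)

/-! ### The cutoffs -/

/-- The frequency cutoff, supported on `[0, 3]`. -/
def freqBump : ContDiffBump (3 / 2 : ℝ) := ⟨5 / 4, 3 / 2, by norm_num, by norm_num⟩

/-- The cutoff in `y` to the dyadic shell `[2^{-j}, 2^{1-j}]`. -/
def shellBump (j : ℕ) : ContDiffBump (3 / 2 * (2 : ℝ) ^ (-(j : ℤ))) :=
  -- Here `1/1024 = 2^{-10}` is the margin prescribed at both ends of the shell.
  ⟨(1 / 2 - 1 / 1024) * (2 : ℝ) ^ (-(j : ℤ)), 1 / 2 * (2 : ℝ) ^ (-(j : ℤ)), by positivity, by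
    gcongr; norm_num⟩

lemma isBump_freqBump : IsBump freqBump 0 3 (1 / 4) (3 - 1 / 4) := by
  refine ⟨freqBump.contDiff, fun t => ⟨freqBump.nonneg, freqBump.le_one⟩, ?_, fun t ht => ?_⟩
  · rw [freqBump.support_eq, Real.ball_eq_Ioo]
    refine Set.Ioo_subset_Icc_self.trans (Set.Icc_subset_Icc ?_ ?_) <;> norm_num [freqBump]
  · apply freqBump.one_of_mem_closedBall
    rw [Real.closedBall_eq_Icc]
    constructor
    · exact le_trans (by norm_num [freqBump]) ht.1
    · exact ht.2.trans (by norm_num [freqBump])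

lemma support_shellBump (j : ℕ) :
    Function.support (shellBump j) = Set.Ioo ((2 : ℝ) ^ (-(j : ℤ))) ((2 : ℝ) ^ (-(j : ℤ) + 1)) := by
  rw [(shellBump j).support_eq, Real.ball_eq_Ioo, zpow_add₀ two_ne_zero]
  simp only [shellBump, zpow_one]
  congr 1 <;> ring

lemma shellBump_eq_one {j : ℕ} {t : ℝ} (ht : t ∈ Set.Icc
    ((2 : ℝ) ^ (-(j : ℤ)) + (2 : ℝ) ^ (-(j : ℤ) - 10))
    ((2 : ℝ) ^ (-(j : ℤ) + 1) - (2 : ℝ) ^ (-(j : ℤ) - 10))) : shellBump j t = 1 := by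
  rw [zpow_add₀ two_ne_zero, zpow_sub₀ two_ne_zero] at ht
  apply (shellBump j).one_of_mem_closedBall
  rw [Real.closedBall_eq_Icc]
  simp only [shellBump]
  norm_num at ht ⊢
  constructor <;> linarith

lemma isBump_shellBump (j : ℕ) : IsBump (shellBump j)
    ((2 : ℝ) ^ (-(j : ℤ))) ((2 : ℝ) ^ (-(j : ℤ) + 1))
    ((2 : ℝ) ^ (-(j : ℤ)) + (2 : ℝ) ^ (-(j : ℤ) - 10))
    ((2 : ℝ) ^ (-(j : ℤ) + 1) - (2 : ℝ) ^ (-(j : ℤ) - 10)) :=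
  ⟨(shellBump j).contDiff, fun _ => ⟨(shellBump j).nonneg, (shellBump j).le_one⟩,
    (support_shellBump j).trans_subset Set.Ioo_subset_Icc_self, fun _ => shellBump_eq_one⟩

lemma integrable_freqBump : Integrable freqBump :=
  freqBump.continuous.integrable_of_hasCompactSupport freqBump.hasCompactSupport

lemma integrable_shellBump (j : ℕ) : Integrable (shellBump j) :=
  (shellBump j).continuous.integrable_of_hasCompactSupport (shellBump j).hasCompactSupport

/-- The supports of the shell cutoffs are disjoint. -/
lemma shellBump_ne_zero_unique {i j : ℕ} {y : ℝ} (hi : shellBump i y ≠ 0)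
    (hj : shellBump j y ≠ 0) : i = j := by
  have key : ∀ {i j : ℕ}, shellBump i y ≠ 0 → shellBump j y ≠ 0 → i ≤ j := fun {i j} hi hj => by
    have hi' : y ∈ Function.support (shellBump i) := hi
    have hj' : y ∈ Function.support (shellBump j) := hj
    rw [support_shellBump] at hi' hj'
    have h := (zpow_lt_zpow_iff_right₀ (one_lt_two (α := ℝ))).1 (hj'.1.trans hi'.2)
    have h' := (zpow_lt_zpow_iff_right₀ (one_lt_two (α := ℝ))).1 (hi'.1.trans hj'.2)
    omega
  exact le_antisymm (key hi hj) (key hj hi)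

lemma exists_schwartz_sum_tensorBump (n : ℕ) : ∃ g : 𝓢(ℝ × ℝ, ℂ), ∀ p,
    g p = ∑ j ∈ Finset.Icc 100 n, tensorBump freqBump (shellBump j) j p := by
  choose G hG using fun j => exists_schwartz_tensorBump freqBump.contDiff
    freqBump.hasCompactSupport (shellBump j).contDiff (shellBump j).hasCompactSupport j
  refine ⟨∑ j ∈ Finset.Icc 100 n, G j, fun p => ?_⟩
  simp [hG]

/-- Disjointness of the shells leaves at most one nonzero term, so the bound does not grow with `n`.
-/
lemma exists_norm_sum_tensorBump_le : ∃ C : ℝ, 0 ≤ C ∧ ∀ (n : ℕ) (p : ℝ × ℝ),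
    ‖∑ j ∈ Finset.Icc 100 n, tensorBump freqBump (shellBump j) j p‖ ≤
      C * Real.exp (-(p.1 ^ 2 + p.2 ^ 2)) := by
  set M := (√(2 * Real.pi))⁻¹ * (2 * ∫ ξ, freqBump ξ) with hM
  have hM0 : 0 ≤ M := by
    have : 0 ≤ ∫ ξ, freqBump ξ := integral_nonneg fun _ => freqBump.nonneg
    positivity
  -- On the supports `0 < y < 2`, so `1 ≤ e^4 e^{-y²}`.
  refine ⟨M * Real.exp 4, by positivity, fun n p => ?_⟩
  have hterm : ∀ j, ‖tensorBump freqBump (shellBump j) j p‖ ≤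
      M * Real.exp 4 * Real.exp (-(p.1 ^ 2 + p.2 ^ 2)) := fun j => by
    rw [tensorBump_eq integrable_freqBump, Complex.norm_real, Real.norm_eq_abs, abs_mul,
      abs_of_nonneg (shellBump j).nonneg]
    by_cases hy : shellBump j p.2 = 0
    · rw [hy]; simp only [zero_mul]; positivity
    have hy' : p.2 ∈ Function.support (shellBump j) := hy
    rw [support_shellBump] at hy'
    have hle : p.2 < 2 := hy'.2.trans_le (by
      calc (2 : ℝ) ^ (-(j : ℤ) + 1) ≤ 2 ^ (1 : ℤ) :=
            zpow_le_zpow_right₀ one_le_two (by omega)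
        _ = 2 := zpow_one _)
    have hpos : 0 < p.2 := lt_trans (by positivity) hy'.1
    have hexp : Real.exp (-p.1 ^ 2) ≤ Real.exp 4 * Real.exp (-(p.1 ^ 2 + p.2 ^ 2)) := by
      rw [← Real.exp_add]
      exact Real.exp_le_exp.2 (by nlinarith)
    calc shellBump j p.2 * |profile freqBump j p.1| ≤ 1 * (M * Real.exp (-p.1 ^ 2)) := by
          gcongr
          · exact (shellBump j).le_one
          · exact abs_profile_le integrable_freqBump (fun _ => freqBump.nonneg) j p.1
      _ ≤ 1 * (M * (Real.exp 4 * Real.exp (-(p.1 ^ 2 + p.2 ^ 2)))) := by gcongr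
      _ = _ := by ring
  by_cases h : ∃ i ∈ Finset.Icc 100 n, shellBump i p.2 ≠ 0
  · obtain ⟨i, hi, hi0⟩ := h
    rw [Finset.sum_eq_single_of_mem i hi]
    · exact hterm i
    · intro j _ hji
      have : shellBump j p.2 = 0 := by
        by_contra hj0
        exact hji (shellBump_ne_zero_unique hj0 hi0)
      simp [tensorBump, this]
  · push Not at h
    rw [Finset.sum_eq_zero fun j hj => by simp [tensorBump, h j hj], norm_zero]
    positivity

/-! ### Gaussian cosine and sine integrals -/

lemma integral_cos_mul_gaussian {b : ℝ} (hb : 0 < b) (t : ℝ) :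
    ∫ x, Real.cos (t * x) * Real.exp (-b * x ^ 2) =
      √(Real.pi / b) * Real.exp (-t ^ 2 / (4 * b)) := by
  have h := fourierIntegral_gaussian (b := (b : ℂ)) (by simpa using hb) (t : ℂ)
  have hint : Integrable fun x : ℝ =>
      Complex.exp (Complex.I * t * x) * Complex.exp (-(b : ℂ) * x ^ 2) := by
    refine (integrable_cexp_neg_mul_sq (b := (b : ℂ)) (by simpa using hb)).bdd_mul (c := 1)
      (by fun_prop) (.of_forall fun x => ?_)
    rw [mul_assoc, ← Complex.ofReal_mul, mul_comm, Complex.norm_exp_ofReal_mul_I]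
  have hre := congrArg Complex.re h
  rw [show (Complex.re (∫ x : ℝ, Complex.exp (Complex.I * t * x) *
    Complex.exp (-(b : ℂ) * x ^ 2))) = ∫ x : ℝ, Complex.re (Complex.exp (Complex.I * t * x) *
    Complex.exp (-(b : ℂ) * x ^ 2)) from (integral_re hint).symm] at hre
  have e1 : ∀ x : ℝ, Complex.re (Complex.exp (Complex.I * t * x) *
      Complex.exp (-(b : ℂ) * x ^ 2)) = Real.cos (t * x) * Real.exp (-b * x ^ 2) := fun x => by
    have : Complex.exp (-(b : ℂ) * x ^ 2) = (Real.exp (-b * x ^ 2) : ℂ) := by push_cast; rfl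
    rw [this, Complex.re_mul_ofReal, mul_assoc, ← Complex.ofReal_mul, mul_comm Complex.I,
      Complex.exp_ofReal_mul_I_re]
  have e2 : ((Real.pi : ℂ) / b) ^ (1 / 2 : ℂ) * Complex.exp (-(t : ℂ) ^ 2 / (4 * b)) =
      ((√(Real.pi / b) * Real.exp (-t ^ 2 / (4 * b)) : ℝ) : ℂ) := by
    rw [Real.sqrt_eq_rpow, Complex.ofReal_mul, Complex.ofReal_cpow (by positivity)]
    push_cast
    rfl
  rw [e2, Complex.ofReal_re] at hre
  simp_rw [e1] at hre
  exact hre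

lemma integrable_mul_gaussian {b : ℝ} (hb : 0 < b) {u : ℝ → ℝ} (hu : Continuous u) {C : ℝ}
    (hC : ∀ x, |u x| ≤ C) : Integrable fun x => u x * Real.exp (-b * x ^ 2) :=
  (integrable_exp_neg_mul_sq hb).bdd_mul (c := C) hu.aestronglyMeasurable (.of_forall hC)

lemma integral_cos_mul_cos_mul_gaussian {b : ℝ} (hb : 0 < b) (s t : ℝ) :
    ∫ x, 2 * Real.cos (s * x) * Real.cos (t * x) * Real.exp (-b * x ^ 2) = √(Real.pi / b) *
      (Real.exp (-(s - t) ^ 2 / (4 * b)) + Real.exp (-(s + t) ^ 2 / (4 * b))) := by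
  have h : ∀ x, 2 * Real.cos (s * x) * Real.cos (t * x) * Real.exp (-b * x ^ 2) =
      Real.cos ((s - t) * x) * Real.exp (-b * x ^ 2) +
        Real.cos ((s + t) * x) * Real.exp (-b * x ^ 2) := fun x => by
    rw [sub_mul, add_mul, Real.cos_sub, Real.cos_add]; ring
  simp_rw [h]
  rw [integral_add (integrable_mul_gaussian hb (by fun_prop) fun x => Real.abs_cos_le_one _)
    (integrable_mul_gaussian hb (by fun_prop) fun x => Real.abs_cos_le_one _),
    integral_cos_mul_gaussian hb, integral_cos_mul_gaussian hb]
  ring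

lemma integral_sin_mul_sin_mul_gaussian {b : ℝ} (hb : 0 < b) (s t : ℝ) :
    ∫ x, Real.sin (s * x) * Real.sin (t * x) * Real.exp (-b * x ^ 2) = √(Real.pi / b) / 2 *
      (Real.exp (-(s - t) ^ 2 / (4 * b)) - Real.exp (-(s + t) ^ 2 / (4 * b))) := by
  have h : ∀ x, Real.sin (s * x) * Real.sin (t * x) * Real.exp (-b * x ^ 2) =
      (1 / 2) * (Real.cos ((s - t) * x) * Real.exp (-b * x ^ 2) -
        Real.cos ((s + t) * x) * Real.exp (-b * x ^ 2)) := fun x => by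
    rw [sub_mul, add_mul, Real.cos_sub, Real.cos_add]; ring
  simp_rw [h]
  rw [integral_const_mul,
    integral_sub (integrable_mul_gaussian hb (by fun_prop) fun x => Real.abs_cos_le_one _)
    (integrable_mul_gaussian hb (by fun_prop) fun x => Real.abs_cos_le_one _),
    integral_cos_mul_gaussian hb, integral_cos_mul_gaussian hb]
  ring

/-! ### The cosine transform of the profile -/

/-- By Fubini the Gaussian factor smooths the cutoff in frequency. The right-hand side is visibly
nonnegative when `χ` is. -/
lemma integral_cos_mul_profile {χ : ℝ → ℝ} (hχ : Integrable χ) (j : ℕ) (s : ℝ) :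
    ∫ x, Real.cos (s * x) * profile χ j x = (√(2 * Real.pi))⁻¹ * (√Real.pi *
      ∫ ξ, (Real.exp (-(s - ξ) ^ 2 / 4) + Real.exp (-(s + ξ) ^ 2 / 4)) * χ (ξ - 2 ^ j)) := by
  have hi : Integrable fun ξ => χ (ξ - 2 ^ j) := hχ.comp_sub_right _
  have h1 : ∀ x, Real.cos (s * x) * profile χ j x = (√(2 * Real.pi))⁻¹ *
      ∫ ξ, (2 * Real.cos (s * x) * Real.cos (ξ * x) * Real.exp (-1 * x ^ 2)) * χ (ξ - 2 ^ j) :=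
    fun x => by
      have h2 : ∀ ξ, (2 * Real.cos (s * x) * Real.cos (ξ * x) * Real.exp (-1 * x ^ 2)) *
          χ (ξ - 2 ^ j) = (Real.cos (s * x) * Real.exp (-x ^ 2)) *
            (2 * Real.cos (x * ξ) * χ (ξ - 2 ^ j)) := fun ξ => by
        rw [neg_one_mul, mul_comm x ξ]; ring
      simp_rw [h2]
      rw [integral_const_mul, profile]
      ring
  simp_rw [h1]
  have hprod : Integrable (Function.uncurry fun x ξ : ℝ =>
      (2 * Real.cos (s * x) * Real.cos (ξ * x) * Real.exp (-1 * x ^ 2)) * χ (ξ - 2 ^ j))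
      (volume.prod volume) := by
    have hb := (integrable_exp_neg_mul_sq (b := 1) one_pos).mul_prod hi
    have := hb.bdd_mul (c := 2)
      (f := fun z : ℝ × ℝ => 2 * Real.cos (s * z.1) * Real.cos (z.2 * z.1))
      (by fun_prop) (.of_forall fun z => by
        have a := Real.abs_cos_le_one (s * z.1)
        have b := Real.abs_cos_le_one (z.2 * z.1)
        rw [Real.norm_eq_abs, abs_mul, abs_mul, abs_of_pos two_pos]
        nlinarith [abs_nonneg (Real.cos (s * z.1)), abs_nonneg (Real.cos (z.2 * z.1))])
    refine this.congr (.of_forall fun z => ?_)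
    simp only [Function.uncurry]
    ring
  rw [integral_const_mul, integral_integral_swap hprod]
  congr 1
  rw [← integral_const_mul]
  congr 1
  ext ξ
  rw [integral_mul_const, integral_cos_mul_cos_mul_gaussian one_pos]
  simp only [div_one, mul_one]
  ring

lemma integrable_gaussian_mul_translate {χ : ℝ → ℝ} (hχ : Integrable χ) (a s : ℝ) :
    Integrable fun ξ =>
      (Real.exp (-(s - ξ) ^ 2 / 4) + Real.exp (-(s + ξ) ^ 2 / 4)) * χ (ξ - a) := by
  refine (hχ.comp_sub_right a).bdd_mul (c := 2) (by fun_prop) (.of_forall fun ξ => ?_)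
  have h1 : Real.exp (-(s - ξ) ^ 2 / 4) ≤ 1 :=
    Real.exp_le_one_iff.2 (by nlinarith [sq_nonneg (s - ξ)])
  have h2 : Real.exp (-(s + ξ) ^ 2 / 4) ≤ 1 :=
    Real.exp_le_one_iff.2 (by nlinarith [sq_nonneg (s + ξ)])
  rw [Real.norm_eq_abs, abs_of_nonneg (by positivity)]
  linarith

lemma integral_cos_mul_profile_nonneg {χ : ℝ → ℝ} (hχ : Integrable χ) (h0 : ∀ t, 0 ≤ χ t)
    (j : ℕ) (s : ℝ) : 0 ≤ ∫ x, Real.cos (s * x) * profile χ j x := by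
  rw [integral_cos_mul_profile hχ]
  have : 0 ≤ ∫ ξ, (Real.exp (-(s - ξ) ^ 2 / 4) + Real.exp (-(s + ξ) ^ 2 / 4)) * χ (ξ - 2 ^ j) :=
    integral_nonneg fun ξ => mul_nonneg (by positivity) (h0 _)
  positivity

lemma exists_le_integral_cos_mul_profile : ∃ c : ℝ, 0 < c ∧ ∀ (j : ℕ) (s : ℝ),
    s ∈ Set.Icc ((2 : ℝ) ^ j) (2 ^ j + 1) → c ≤ ∫ x, Real.cos (s * x) * profile freqBump j x := by
  -- Since `s ∈ [2^j, 2^j + 1]` and `ξ ∈ [2^j, 2^j + 3]`, one has `|s - ξ| ≤ 3`, whence `e^{-9/4}`;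
  -- the other Gaussian is dropped.
  refine ⟨(√(2 * Real.pi))⁻¹ * (√Real.pi * (Real.exp (-9 / 4) * ∫ ξ, freqBump ξ)), ?_,
    fun j s hs => ?_⟩
  · have : 0 < ∫ ξ, freqBump ξ := freqBump.integral_pos
    positivity
  rw [integral_cos_mul_profile integrable_freqBump]
  gcongr
  rw [← integral_sub_right_eq_self freqBump ((2 : ℝ) ^ j), ← integral_const_mul]
  refine integral_mono ((integrable_freqBump.comp_sub_right _).const_mul _)
    (integrable_gaussian_mul_translate integrable_freqBump _ _) fun ξ => ?_
  by_cases hξ : freqBump (ξ - 2 ^ j) = 0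
  · simp [hξ]
  have hmem := isBump_freqBump.2.2.1 (show ξ - 2 ^ j ∈ Function.support freqBump from hξ)
  have h1 : Real.exp (-9 / 4) ≤ Real.exp (-(s - ξ) ^ 2 / 4) := by
    refine Real.exp_le_exp.2 ?_
    have a1 : s - ξ ≤ 3 := by linarith [hs.1, hs.2, hmem.1, hmem.2]
    have a2 : -3 ≤ s - ξ := by linarith [hs.1, hs.2, hmem.1, hmem.2]
    nlinarith
  have h2 : 0 < Real.exp (-(s + ξ) ^ 2 / 4) := Real.exp_pos _
  exact mul_le_mul_of_nonneg_right (by linarith) freqBump.nonneg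

/-! ### The test function -/

/-- The function `∑ sin(2^k x) e^{-x²}`, against which the double Riesz transform is tested. -/
def testFun (n : ℕ) (x : ℝ) : ℝ :=
  ∑ k ∈ Finset.Icc 100 n, Real.sin (2 ^ k * x) * Real.exp (-x ^ 2)

lemma continuous_testFun (n : ℕ) : Continuous (testFun n) := by
  unfold testFun; fun_prop

lemma integrable_testFun (n : ℕ) : Integrable (testFun n) := by
  unfold testFun
  refine integrable_finsetSum _ fun k _ => ?_
  simpa using integrable_mul_gaussian (b := 1) one_pos (u := fun x => Real.sin (2 ^ k * x))
    (by fun_prop) fun x => Real.abs_sin_le_one _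

lemma integral_sin_mul_testFun (n : ℕ) (s : ℝ) :
    ∫ x, Real.sin (s * x) * testFun n x = ∑ k ∈ Finset.Icc 100 n, √Real.pi / 2 *
      (Real.exp (-(s - 2 ^ k) ^ 2 / 4) - Real.exp (-(s + 2 ^ k) ^ 2 / 4)) := by
  simp_rw [testFun, Finset.mul_sum]
  rw [integral_finsetSum]
  · refine Finset.sum_congr rfl fun k _ => ?_
    have := integral_sin_mul_sin_mul_gaussian one_pos s (2 ^ k)
    simpa [mul_assoc] using this
  · intro k _
    have := integrable_mul_gaussian (b := 1) one_pos
      (u := fun x => Real.sin (s * x) * Real.sin (2 ^ k * x)) (C := 1) (by fun_prop) fun x => by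
        rw [abs_mul]
        exact mul_le_one₀ (Real.abs_sin_le_one _) (abs_nonneg _) (Real.abs_sin_le_one _)
    simpa [mul_assoc] using this

lemma exp_neg_sub_sq_le {s t b : ℝ} (hb : 0 < b) (hs : 0 ≤ s) (ht : 0 ≤ t) :
    Real.exp (-(s + t) ^ 2 / b) ≤ Real.exp (-(s - t) ^ 2 / b) := by
  refine Real.exp_le_exp.2 ?_
  refine div_le_div_of_nonneg_right ?_ hb.le
  nlinarith [mul_nonneg hs ht]

/-- Each frequency contributes a nonnegative term, as `|s - 2^k| ≤ s + 2^k`. Hence a single scale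
may be retained in lower bounds. -/
lemma integral_sin_mul_testFun_nonneg (n : ℕ) {s : ℝ} (hs : 0 ≤ s) :
    0 ≤ ∫ x, Real.sin (s * x) * testFun n x := by
  rw [integral_sin_mul_testFun]
  refine Finset.sum_nonneg fun k _ => mul_nonneg (by positivity) ?_
  exact sub_nonneg.2 (exp_neg_sub_sq_le (by norm_num) hs (by positivity))

lemma exists_le_integral_sin_mul_testFun : ∃ c : ℝ, 0 < c ∧ ∀ (n j : ℕ) (s : ℝ),
    j ∈ Finset.Icc 100 n → s ∈ Set.Icc ((2 : ℝ) ^ j) (2 ^ j + 1) →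
      c ≤ ∫ x, Real.sin (s * x) * testFun n x := by
  -- Only the term `k = j` is kept, with `(s - 2^j)² ≤ 1` and `(s + 2^j)² ≥ 4`.
  refine ⟨√Real.pi / 2 * (Real.exp (-1 / 4) - Real.exp (-1)), ?_, fun n j s hj hs => ?_⟩
  · have : Real.exp (-1) < Real.exp (-1 / 4) := Real.exp_lt_exp.2 (by norm_num)
    have := sub_pos.2 this
    positivity
  have hp : (1 : ℝ) ≤ 2 ^ j := one_le_pow₀ one_le_two
  rw [integral_sin_mul_testFun]
  refine le_trans ?_ (Finset.single_le_sum (fun k _ => mul_nonneg (by positivity) (sub_nonneg.2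
    (exp_neg_sub_sq_le (by norm_num) (by linarith [hs.1]) (by positivity)))) hj)
  gcongr
  · have : (s - 2 ^ j) ^ 2 ≤ 1 := by nlinarith [hs.1, hs.2]
    linarith
  · have : 4 ≤ (s + 2 ^ j) ^ 2 := by nlinarith [hs.1, hs.2]
    linarith

/-- For `k < j` the gap is at least `2^j / 2`, so the exponent is at least `T = 2^j 2^k / 32`, and
`e^{-T} ≤ 1/T`. The product form sums as two geometric series. -/
lemma exp_neg_dyadic_sq_le {j k : ℕ} (h : j ≠ k) :
    Real.exp (-((2 : ℝ) ^ j - 2 ^ k) ^ 2 / 8) ≤ 32 * ((1 / 2) ^ j * (1 / 2) ^ k) := by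
  wlog hjk : k < j generalizing j k
  · have := this h.symm (by omega)
    rw [mul_comm ((1 / 2 : ℝ) ^ j)]
    convert this using 3
    ring
  have hk0 : (0 : ℝ) < 2 ^ k := by positivity
  have hj0 : (0 : ℝ) < 2 ^ j := by positivity
  have hle : (2 : ℝ) ^ k * 2 ≤ 2 ^ j := by
    rw [← pow_succ]; exact pow_le_pow_right₀ one_le_two hjk
  have hT : (2 : ℝ) ^ j * 2 ^ k / 32 ≤ ((2 : ℝ) ^ j - 2 ^ k) ^ 2 / 8 := by nlinarith
  have hexp : Real.exp (-((2 : ℝ) ^ j - 2 ^ k) ^ 2 / 8) ≤ ((2 : ℝ) ^ j * 2 ^ k / 32)⁻¹ := by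
    rw [neg_div, Real.exp_neg]
    gcongr
    exact hT.trans ((le_add_of_nonneg_right zero_le_one).trans (Real.add_one_le_exp _))
  refine hexp.trans (le_of_eq ?_)
  rw [one_div, inv_pow, inv_pow]
  field_simp

/-- Almost orthogonality: at most `n` diagonal terms, each at most 1, and a remainder at most `32 ·
2 · 2 = 128`. -/
lemma integral_testFun_sq_le (n : ℕ) : ∫ x, testFun n x ^ 2 ≤ n + 128 := by
  have hexpand : ∀ x, testFun n x ^ 2 = ∑ j ∈ Finset.Icc 100 n, ∑ k ∈ Finset.Icc 100 n,
      Real.sin (2 ^ j * x) * Real.sin (2 ^ k * x) * Real.exp (-2 * x ^ 2) := fun x => by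
    rw [sq, testFun, Finset.sum_mul_sum]
    refine Finset.sum_congr rfl fun j _ => Finset.sum_congr rfl fun k _ => ?_
    rw [show -2 * x ^ 2 = -x ^ 2 + -x ^ 2 by ring, Real.exp_add]
    ring
  have hint : ∀ j k : ℕ, Integrable fun x =>
      Real.sin (2 ^ j * x) * Real.sin (2 ^ k * x) * Real.exp (-2 * x ^ 2) := fun j k =>
    integrable_mul_gaussian (b := 2) two_pos
      (u := fun x => Real.sin (2 ^ j * x) * Real.sin (2 ^ k * x)) (C := 1) (by fun_prop) fun x => by
        rw [abs_mul]
        exact mul_le_one₀ (Real.abs_sin_le_one _) (abs_nonneg _) (Real.abs_sin_le_one _)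
  have hsqrt : √(Real.pi / 2) / 2 ≤ 1 := by
    have : √(Real.pi / 2) ≤ 2 := by
      rw [Real.sqrt_le_left two_pos.le]
      linarith [Real.pi_le_four]
    linarith
  have hterm : ∀ j k : ℕ, ∫ x, Real.sin (2 ^ j * x) * Real.sin (2 ^ k * x) *
      Real.exp (-2 * x ^ 2) ≤ (if j = k then 1 else 0) + 32 * ((1 / 2) ^ j * (1 / 2) ^ k) :=
    fun j k => by
      rw [integral_sin_mul_sin_mul_gaussian two_pos]
      have h1 : Real.exp (-((2 : ℝ) ^ j - 2 ^ k) ^ 2 / (4 * 2)) ≤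
          (if j = k then 1 else 0) + 32 * ((1 / 2) ^ j * (1 / 2) ^ k) := by
        split_ifs with h
        · subst h
          have : (0 : ℝ) ≤ 32 * ((1 / 2) ^ j * (1 / 2) ^ j) := by positivity
          simp only [sub_self]
          norm_num
        · rw [zero_add]
          convert exp_neg_dyadic_sq_le h using 3
          norm_num
      have h2 : 0 < Real.exp (-((2 : ℝ) ^ j + 2 ^ k) ^ 2 / (4 * 2)) := Real.exp_pos _
      have h3 := Real.exp_pos (-((2 : ℝ) ^ j - 2 ^ k) ^ 2 / (4 * 2))
      have h4 : 0 ≤ √(Real.pi / 2) / 2 := by positivity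
      nlinarith
  have hgeom : ∑ j ∈ Finset.Icc 100 n, (1 / 2 : ℝ) ^ j ≤ 2 := by
    calc ∑ j ∈ Finset.Icc 100 n, (1 / 2 : ℝ) ^ j ≤ ∑' j : ℕ, (1 / 2 : ℝ) ^ j :=
          summable_geometric_two.sum_le_tsum _ fun _ _ => by positivity
      _ = 2 := tsum_geometric_two
  have hgeom0 : 0 ≤ ∑ j ∈ Finset.Icc 100 n, (1 / 2 : ℝ) ^ j :=
    Finset.sum_nonneg fun _ _ => by positivity
  simp_rw [hexpand]
  rw [integral_finsetSum _ fun j _ => integrable_finsetSum _ fun k _ => hint j k]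
  simp_rw [integral_finsetSum (Finset.Icc 100 n) fun k _ => hint _ k]
  calc _ ≤ ∑ j ∈ Finset.Icc 100 n, ∑ k ∈ Finset.Icc 100 n,
        ((if j = k then 1 else 0) + 32 * ((1 / 2 : ℝ) ^ j * (1 / 2) ^ k)) :=
        Finset.sum_le_sum fun j _ => Finset.sum_le_sum fun k _ => hterm j k
    _ = (∑ j ∈ Finset.Icc 100 n, if j ∈ Finset.Icc 100 n then 1 else 0) +
        32 * ((∑ j ∈ Finset.Icc 100 n, (1 / 2 : ℝ) ^ j) *
          ∑ k ∈ Finset.Icc 100 n, (1 / 2 : ℝ) ^ k) := by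
        rw [Finset.sum_mul_sum, Finset.mul_sum, ← Finset.sum_add_distrib]
        refine Finset.sum_congr rfl fun j _ => ?_
        rw [Finset.sum_add_distrib, Finset.sum_ite_eq, Finset.mul_sum]
    _ ≤ n + 32 * (2 * 2) := by
        gcongr
        rw [Finset.sum_congr rfl fun j hj => if_pos hj, Finset.sum_const, Nat.card_Icc,
          nsmul_eq_mul, mul_one]
        exact_mod_cast (by omega : n + 1 - 100 ≤ n)
    _ = _ := by norm_num

/-! ### The kernel as a Laplace transform -/

lemma integrableOn_mul_exp_neg_mul {Y : ℝ} (hY : 0 < Y) :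
    IntegrableOn (fun s => s * Real.exp (-(Y * s))) (Set.Ioi 0) := by
  have := integrableOn_rpow_mul_exp_neg_mul_rpow (s := 1) (p := 1) (b := Y) (by norm_num)
    one_pos hY
  simpa using this

/-- This is the imaginary part of `∫ s e^{-(Y - iu)s} ds = (Y - iu)^{-2}`. -/
lemma integral_mul_exp_neg_mul_sin {Y : ℝ} (hY : 0 < Y) (u : ℝ) :
    ∫ s in Set.Ioi (0 : ℝ), s * Real.exp (-(Y * s)) * Real.sin (u * s) =
      2 * Y * u / (u ^ 2 + Y ^ 2) ^ 2 := by
  set R := u ^ 2 + Y ^ 2 with hR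
  have hR0 : R ≠ 0 := by positivity
  -- The primitive is the imaginary part of `-(s/(Y - iu) + 1/(Y - iu)²) e^{-(Y - iu)s}`.
  let G : ℝ → ℝ := fun s => -((s * Real.exp (-(Y * s))) *
      (Y / R * Real.sin (u * s) + u / R * Real.cos (u * s)) + Real.exp (-(Y * s)) *
      ((Y ^ 2 - u ^ 2) / R ^ 2 * Real.sin (u * s) + 2 * Y * u / R ^ 2 * Real.cos (u * s)))
  have hderiv : ∀ s, HasDerivAt G (s * Real.exp (-(Y * s)) * Real.sin (u * s)) s := fun s => by
    have he : HasDerivAt (fun s => Real.exp (-(Y * s))) (Real.exp (-(Y * s)) * (-(Y * 1))) s :=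
      ((hasDerivAt_id s).const_mul Y).neg.exp
    have hs : HasDerivAt (fun s => Real.sin (u * s)) (Real.cos (u * s) * (u * 1)) s :=
      ((hasDerivAt_id s).const_mul u).sin
    have hc : HasDerivAt (fun s => Real.cos (u * s)) (-Real.sin (u * s) * (u * 1)) s :=
      ((hasDerivAt_id s).const_mul u).cos
    have := ((((hasDerivAt_id s).mul he).mul ((hs.const_mul (Y / R)).add
      (hc.const_mul (u / R)))).add (he.mul ((hs.const_mul ((Y ^ 2 - u ^ 2) / R ^ 2)).add
      (hc.const_mul (2 * Y * u / R ^ 2))))).neg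
    refine this.congr_deriv ?_
    simp only [Pi.mul_apply, Pi.add_apply, id]
    field_simp
    rw [hR]
    ring
  have hbdd : ∀ a b : ℝ, ∀ s, ‖a * Real.sin (u * s) + b * Real.cos (u * s)‖ ≤ |a| + |b| :=
    fun a b s => by
      refine (norm_add_le _ _).trans ?_
      rw [norm_mul, norm_mul, Real.norm_eq_abs, Real.norm_eq_abs, Real.norm_eq_abs,
        Real.norm_eq_abs]
      exact add_le_add (mul_le_of_le_one_right (abs_nonneg _) (Real.abs_sin_le_one _))
        (mul_le_of_le_one_right (abs_nonneg _) (Real.abs_cos_le_one _))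
  have hlim : Tendsto G atTop (𝓝 0) := by
    have t1 : Tendsto (fun s : ℝ => s * Real.exp (-(Y * s))) atTop (𝓝 0) := by
      have := tendsto_rpow_mul_exp_neg_mul_atTop_nhds_zero 1 Y hY
      simpa using this
    have t0 : Tendsto (fun s : ℝ => Real.exp (-(Y * s))) atTop (𝓝 0) := by
      have := tendsto_rpow_mul_exp_neg_mul_atTop_nhds_zero 0 Y hY
      simpa using this
    have b1 := t1.zero_mul_isBoundedUnder_le (isBoundedUnder_of ⟨_, hbdd (Y / R) (u / R)⟩)
    have b0 := t0.zero_mul_isBoundedUnder_le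
      (isBoundedUnder_of ⟨_, hbdd ((Y ^ 2 - u ^ 2) / R ^ 2) (2 * Y * u / R ^ 2)⟩)
    simpa [G] using (b1.add b0).neg
  have hint : IntegrableOn (fun s => s * Real.exp (-(Y * s)) * Real.sin (u * s)) (Set.Ioi 0) :=
    (integrableOn_mul_exp_neg_mul hY).mul_bdd (c := 1) (by fun_prop)
      (.of_forall fun s => Real.abs_sin_le_one _)
  rw [integral_Ioi_of_hasDerivAt_of_tendsto' (fun s _ => hderiv s) hint hlim]
  simp [G]

lemma kernel_eq_integral {Y : ℝ} (hY : 0 < Y) (u : ℝ) :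
    kernel (u, -Y) = -(1 / (4 * Real.pi)) *
      ∫ s in Set.Ioi (0 : ℝ), s * Real.exp (-(Y * s)) * Real.sin (u * s) := by
  rw [integral_mul_exp_neg_mul_sin hY, kernel]
  simp only [neg_sq]
  field_simp
  ring

/-- In the addition formula for `sin`, the term with the sine transform of `a` vanishes by parity.
-/
lemma integral_mul_sin_sub_of_even {h a : ℝ → ℝ} (hh : Integrable h) (ha : Integrable a)
    (hev : ∀ x, a (-x) = a x) (s : ℝ) :
    ∫ z : ℝ × ℝ, h z.1 * a z.2 * Real.sin ((z.1 - z.2) * s) =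
      (∫ x, Real.sin (s * x) * h x) * ∫ x, Real.cos (s * x) * a x := by
  have hs : ∀ {f : ℝ → ℝ}, Integrable f → Integrable fun x => Real.sin (s * x) * f x :=
    fun hf => hf.bdd_mul (c := 1) (by fun_prop) (.of_forall fun x => Real.abs_sin_le_one _)
  have hc : ∀ {f : ℝ → ℝ}, Integrable f → Integrable fun x => Real.cos (s * x) * f x :=
    fun hf => hf.bdd_mul (c := 1) (by fun_prop) (.of_forall fun x => Real.abs_cos_le_one _)
  have hodd : ∫ x, Real.sin (s * x) * a x = 0 := by
    have h1 := integral_neg_eq_self (fun x => Real.sin (s * x) * a x) volume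
    simp only [mul_neg, Real.sin_neg, hev, neg_mul, integral_neg] at h1
    linarith
  have hsplit : ∀ z : ℝ × ℝ, h z.1 * a z.2 * Real.sin ((z.1 - z.2) * s) =
      (Real.sin (s * z.1) * h z.1) * (Real.cos (s * z.2) * a z.2) -
      (Real.cos (s * z.1) * h z.1) * (Real.sin (s * z.2) * a z.2) := fun z => by
    rw [sub_mul, Real.sin_sub, mul_comm z.1 s, mul_comm z.2 s]; ring
  simp_rw [hsplit]
  have e := integral_sub ((hs hh).mul_prod (hc ha)) ((hc hh).mul_prod (hs ha))
  rw [← Measure.volume_eq_prod] at e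
  rw [e, Measure.volume_eq_prod, integral_prod_mul (fun x => Real.sin (s * x) * h x)
    (fun x => Real.cos (s * x) * a x), integral_prod_mul (fun x => Real.cos (s * x) * h x)
    (fun x => Real.sin (s * x) * a x), hodd, mul_zero, sub_zero]

lemma integrable_pairing_laplace {h a : ℝ → ℝ} (hh : Integrable h) (ha : Integrable a) {Y : ℝ}
    (hY : 0 < Y) : Integrable (Function.uncurry fun (z : ℝ × ℝ) (s : ℝ) =>
      h z.1 * a z.2 * (s * Real.exp (-(Y * s)) * Real.sin ((z.1 - z.2) * s)))
      (volume.prod (volume.restrict (Set.Ioi 0))) := by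
  have h1 := (hh.mul_prod ha).mul_prod (integrableOn_mul_exp_neg_mul hY)
  have h2 := h1.mul_bdd (c := 1)
    (g := fun w : (ℝ × ℝ) × ℝ => Real.sin ((w.1.1 - w.1.2) * w.2))
    (by fun_prop) (.of_forall fun w => Real.abs_sin_le_one _)
  refine h2.congr (.of_forall fun w => ?_)
  simp only [Function.uncurry]
  ring

lemma integral_pairing_kernel {h a : ℝ → ℝ} (hh : Integrable h) (ha : Integrable a)
    (hev : ∀ x, a (-x) = a x) {Y : ℝ} (hY : 0 < Y) :
    ∫ z : ℝ × ℝ, h z.1 * a z.2 * kernel (z.1 - z.2, -Y) = -(1 / (4 * Real.pi)) *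
      ∫ s in Set.Ioi (0 : ℝ), s * Real.exp (-(Y * s)) *
        ((∫ x, Real.sin (s * x) * h x) * ∫ x, Real.cos (s * x) * a x) := by
  have h1 : ∀ z : ℝ × ℝ, h z.1 * a z.2 * kernel (z.1 - z.2, -Y) = -(1 / (4 * Real.pi)) *
      ∫ s in Set.Ioi (0 : ℝ), h z.1 * a z.2 *
        (s * Real.exp (-(Y * s)) * Real.sin ((z.1 - z.2) * s)) := fun z => by
    rw [kernel_eq_integral hY, integral_const_mul]; ring
  simp_rw [h1]
  rw [integral_const_mul, integral_integral_swap (integrable_pairing_laplace hh ha hY)]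
  congr 2
  ext s
  rw [← integral_mul_sin_sub_of_even hh ha hev, ← integral_const_mul]
  congr 1
  ext z
  ring

lemma integrableOn_pairing_laplace {h a : ℝ → ℝ} (hh : Integrable h) (ha : Integrable a)
    (hev : ∀ x, a (-x) = a x) {Y : ℝ} (hY : 0 < Y) :
    IntegrableOn (fun s => s * Real.exp (-(Y * s)) *
      ((∫ x, Real.sin (s * x) * h x) * ∫ x, Real.cos (s * x) * a x)) (Set.Ioi 0) := by
  refine (integrable_pairing_laplace hh ha hY).integral_prod_right.congr (.of_forall fun s => ?_)
  simp only [Function.uncurry]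
  rw [← integral_mul_sin_sub_of_even hh ha hev, ← integral_const_mul]
  congr 1
  ext z
  ring

/-- The Laplace integrand is nonnegative, so it may be restricted to the unit interval `[2^j, 2^j +
1]`. There the factor `s` gives `2^j` and the other factors are bounded below. -/
lemma exists_integral_pairing_kernel_le : ∃ c : ℝ, 0 < c ∧ ∀ (n j : ℕ) (Y : ℝ),
    j ∈ Finset.Icc 100 n → 0 < Y → Y ≤ 3 * (2 : ℝ) ^ (-(j : ℤ)) →
      ∫ z : ℝ × ℝ, testFun n z.1 * profile freqBump j z.2 * kernel (z.1 - z.2, -Y) ≤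
        -(c * 2 ^ j) := by
  obtain ⟨c₁, hc₁, h₁⟩ := exists_le_integral_sin_mul_testFun
  obtain ⟨c₂, hc₂, h₂⟩ := exists_le_integral_cos_mul_profile
  refine ⟨1 / (4 * Real.pi) * (Real.exp (-6) * (c₁ * c₂)), by positivity,
    fun n j Y hj hY hYle => ?_⟩
  have hh := integrable_testFun n
  have ha := integrable_profile integrable_freqBump (fun _ => freqBump.nonneg) j
  have hpow : (2 : ℝ) ^ (-(j : ℤ)) = (2 ^ j)⁻¹ := by rw [zpow_neg, zpow_natCast]
  have hp1 : (1 : ℝ) ≤ 2 ^ j := one_le_pow₀ one_le_two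
  have hp : (0 : ℝ) < 2 ^ j := by positivity
  rw [hpow] at hYle
  rw [integral_pairing_kernel hh ha (profile_neg _ j) hY]
  have hint := integrableOn_pairing_laplace hh ha (profile_neg _ j) hY
  have hsub : Set.Icc ((2 : ℝ) ^ j) (2 ^ j + 1) ⊆ Set.Ioi 0 := fun s hs => hp.trans_le hs.1
  have hnn : ∀ s ∈ Set.Ioi (0 : ℝ), 0 ≤ s * Real.exp (-(Y * s)) *
      ((∫ x, Real.sin (s * x) * testFun n x) * ∫ x, Real.cos (s * x) * profile freqBump j x) :=
    fun s hs => mul_nonneg (mul_nonneg (le_of_lt hs) (Real.exp_pos _).le)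
      (mul_nonneg (integral_sin_mul_testFun_nonneg n (le_of_lt hs))
        (integral_cos_mul_profile_nonneg integrable_freqBump (fun _ => freqBump.nonneg) j s))
  have hkey : 2 ^ j * Real.exp (-6) * (c₁ * c₂) ≤ ∫ s in Set.Ioi (0 : ℝ),
      s * Real.exp (-(Y * s)) * ((∫ x, Real.sin (s * x) * testFun n x) *
        ∫ x, Real.cos (s * x) * profile freqBump j x) := by
    calc 2 ^ j * Real.exp (-6) * (c₁ * c₂)
        = ∫ _ in Set.Icc ((2 : ℝ) ^ j) (2 ^ j + 1), 2 ^ j * Real.exp (-6) * (c₁ * c₂) := by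
          simp [Measure.real]
      _ ≤ ∫ s in Set.Icc ((2 : ℝ) ^ j) (2 ^ j + 1), s * Real.exp (-(Y * s)) *
          ((∫ x, Real.sin (s * x) * testFun n x) *
            ∫ x, Real.cos (s * x) * profile freqBump j x) := by
          refine setIntegral_mono_on (integrable_const _) (hint.mono_set hsub)
            measurableSet_Icc fun s hs => ?_
          -- From `Y ≤ 3 · 2^{-j}` and `s ≤ 2^j + 1 ≤ 2 · 2^j`.
          have hYs : Y * s ≤ 6 := by
            calc Y * s ≤ 3 * (2 ^ j)⁻¹ * (2 * 2 ^ j) := by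
                  gcongr
                  · exact hp.le.trans hs.1
                  · linarith [hs.2]
              _ = 6 := by field_simp; norm_num
          have hs0 : 0 < s := hsub hs
          have b₁ := h₁ n j s hj hs
          have b₂ := h₂ j s hs
          have b₁' := hc₁.le.trans b₁
          have b₃ := hs.1
          gcongr
      _ ≤ _ := setIntegral_mono_set hint
          ((ae_restrict_iff' measurableSet_Ioi).2 (.of_forall hnn)) hsub.eventuallyLE
  have h4 : 0 < 1 / (4 * Real.pi) := by positivity
  nlinarith [mul_le_mul_of_nonneg_left hkey h4.le]

/-! ### The double Riesz transform below the support -/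

/-- If `f` vanishes in the lower half plane, then there the principal value is the plain
integral. -/
lemma R₁₂_eq_integral_of_neg {f : ℝ × ℝ → ℂ} (hf : ∀ q : ℝ × ℝ, q.2 ≤ 0 → f q = 0) {p : ℝ × ℝ}
    (hp : p.2 < 0) : R₁₂ f p = ∫ q, (kernel (p - q) : ℂ) * f q := by
  refine Tendsto.limUnder_eq (tendsto_const_nhds.congr' ?_)
  -- For `ε < -p.2` the excised disc lies in the lower half plane, where `f` vanishes.
  filter_upwards [Ioo_mem_nhdsGT (neg_pos.2 hp)] with ε hε
  refine (setIntegral_eq_integral_of_forall_compl_eq_zero fun q hq => ?_).symm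
  simp only [Set.mem_ofPred_eq, not_lt] at hq
  rw [hf q, mul_zero]
  have h1 : |p.2 - q.2| ≤ ε := by
    refine le_trans (Real.abs_le_sqrt ?_) hq
    linarith [sq_nonneg (p.1 - q.1)]
  linarith [(abs_le.1 h1).1, hε.2]

/-- The contribution to the double Riesz transform of the tensor bump at scale `2^j`. -/
def shellTransform (j : ℕ) (p : ℝ × ℝ) : ℝ :=
  ∫ q : ℝ × ℝ, kernel (p - q) * (shellBump j q.2 * profile freqBump j q.1)

lemma shellBump_of_nonpos (j : ℕ) {y : ℝ} (hy : y ≤ 0) : shellBump j y = 0 := by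
  by_contra h
  have h' : y ∈ Function.support (shellBump j) := h
  rw [support_shellBump] at h'
  exact absurd (lt_trans (by positivity) h'.1) hy.not_gt

lemma measurable_profile (j : ℕ) : Measurable (profile freqBump j) :=
  (continuous_profile integrable_freqBump j).measurable

lemma measurable_shellBump (j : ℕ) : Measurable (shellBump j) := (shellBump j).continuous.measurable

/-- On the support of the bump `t > 0 > y`, so the vertical distance is at least `|y|`. -/
lemma abs_kernel_mul_shellBump_le {y : ℝ} (hy : y < 0) (j : ℕ) (u t : ℝ) :
    |kernel (u, y - t) * shellBump j t| ≤ (y ^ 2)⁻¹ * shellBump j t := by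
  rcases le_or_gt t 0 with ht | ht
  · simp [shellBump_of_nonpos j ht]
  rw [abs_mul, abs_of_nonneg (shellBump j).nonneg]
  gcongr
  · exact (shellBump j).nonneg
  refine (abs_kernel_le _).trans ?_
  have : 0 < y ^ 2 := by nlinarith
  gcongr
  simp only
  nlinarith [sq_nonneg u]

lemma integrable_kernel_mul_tensor (j : ℕ) {p : ℝ × ℝ} (hp : p.2 < 0) :
    Integrable fun q : ℝ × ℝ => kernel (p - q) * (shellBump j q.2 * profile freqBump j q.1) := by
  have ha := integrable_profile integrable_freqBump (fun _ => freqBump.nonneg) j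
  have hm1 := measurable_profile j
  have hm2 := measurable_shellBump j
  refine ((ha.norm.mul_prod (integrable_shellBump j)).const_mul (p.2 ^ 2)⁻¹).mono'
    (Measurable.aestronglyMeasurable (by fun_prop)) (.of_forall fun q => ?_)
  have := abs_kernel_mul_shellBump_le hp j (p.1 - q.1) q.2
  rw [← mul_assoc, norm_mul, Real.norm_eq_abs]
  calc _ ≤ (p.2 ^ 2)⁻¹ * shellBump j q.2 * ‖profile freqBump j q.1‖ :=
        mul_le_mul_of_nonneg_right this (norm_nonneg _)
    _ = _ := by ring

lemma integrable_testFun_mul_kernel (n j : ℕ) {y : ℝ} (hy : y < 0) :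
    Integrable fun w : ℝ × ℝ × ℝ => testFun n w.1 * (kernel ((w.1, y) - w.2) *
      (shellBump j w.2.2 * profile freqBump j w.2.1)) := by
  have ha := integrable_profile integrable_freqBump (fun _ => freqBump.nonneg) j
  have hm1 := measurable_profile j
  have hm2 := measurable_shellBump j
  have hm3 := (continuous_testFun n).measurable
  refine (((integrable_testFun n).norm.mul_prod
    (ha.norm.mul_prod (integrable_shellBump j))).const_mul (y ^ 2)⁻¹).mono'
    (Measurable.aestronglyMeasurable (by fun_prop)) (.of_forall fun w => ?_)
  have := abs_kernel_mul_shellBump_le hy j (w.1 - w.2.1) w.2.2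
  rw [← mul_assoc (kernel _), norm_mul, norm_mul, Real.norm_eq_abs (kernel _ * _)]
  calc _ ≤ ‖testFun n w.1‖ * ((y ^ 2)⁻¹ * shellBump j w.2.2 * ‖profile freqBump j w.2.1‖) := by
        gcongr
        exact this
    _ = _ := by ring

lemma measurable_shellTransform (j : ℕ) (y : ℝ) : Measurable fun x => shellTransform j (x, y) := by
  have hm1 := measurable_profile j
  have hm2 := measurable_shellBump j
  have : Measurable (Function.uncurry fun (x : ℝ) (q : ℝ × ℝ) =>
      kernel ((x, y) - q) * (shellBump j q.2 * profile freqBump j q.1)) := by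
    unfold Function.uncurry
    fun_prop
  exact (this.stronglyMeasurable.integral_prod_right (ν := volume)).measurable

lemma le_integral_shellBump (j : ℕ) : 1 / 2 * (2 : ℝ) ^ (-(j : ℤ)) ≤ ∫ t, shellBump j t := by
  refine le_trans ?_ ((shellBump j).measure_closedBall_le_integral volume)
  have h : (0 : ℝ) < 2 ^ (-(j : ℤ)) := by positivity
  rw [Real.volume_real_closedBall (shellBump j).rIn_pos.le]
  simp only [shellBump]
  linarith

/-- The factor `2^j` from the kernel pairing is offset by the shell's thickness, so every scale
contributes at least the same constant, with the same sign. -/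
lemma exists_integral_testFun_mul_shellTransform_le : ∃ c : ℝ, 0 < c ∧ ∀ (n j : ℕ) (y : ℝ),
    j ∈ Finset.Icc 100 n → y ∈ Set.Ioo (-(2 : ℝ) ^ (-(n : ℤ))) 0 →
      ∫ x, testFun n x * shellTransform j (x, y) ≤ -c := by
  obtain ⟨c, hc, h⟩ := exists_integral_pairing_kernel_le
  refine ⟨c / 2, by positivity, fun n j y hj hy => ?_⟩
  have hF := integrable_testFun_mul_kernel n j hy.2
  have hassoc : MeasurePreserving (MeasurableEquiv.prodAssoc : (ℝ × ℝ) × ℝ ≃ᵐ ℝ × ℝ × ℝ)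
      ((volume.prod volume).prod volume) (volume.prod (volume.prod volume)) :=
    measurePreserving_prodAssoc volume volume volume
  have hF' : Integrable (fun w : (ℝ × ℝ) × ℝ => testFun n w.1.1 *
      (kernel ((w.1.1, y) - (w.1.2, w.2)) * (shellBump j w.2 * profile freqBump j w.1.2)))
      ((volume.prod volume).prod volume) :=
    (hassoc.integrable_comp_emb MeasurableEquiv.prodAssoc.measurableEmbedding).2 hF
  have hswap : ∫ x, testFun n x * shellTransform j (x, y) = ∫ t, ∫ z : ℝ × ℝ,
      testFun n z.1 * (kernel ((z.1, y) - (z.2, t)) *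
        (shellBump j t * profile freqBump j z.2)) := by
    have e1 : ∫ x, testFun n x * shellTransform j (x, y) = ∫ w : ℝ × ℝ × ℝ,
        testFun n w.1 * (kernel ((w.1, y) - w.2) *
          (shellBump j w.2.2 * profile freqBump j w.2.1)) := by
      rw [Measure.volume_eq_prod, integral_prod _ hF]
      simp_rw [integral_const_mul]
      rfl
    have e2 := hassoc.integral_comp' (fun w : ℝ × ℝ × ℝ => testFun n w.1 *
      (kernel ((w.1, y) - w.2) * (shellBump j w.2.2 * profile freqBump j w.2.1)))
    rw [e1]
    refine e2.symm.trans ?_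
    exact integral_prod_symm _ hF'
  have hJ : Integrable fun t => ∫ z : ℝ × ℝ, testFun n z.1 *
      (kernel ((z.1, y) - (z.2, t)) * (shellBump j t * profile freqBump j z.2)) :=
    hF'.integral_prod_right
  have hpt : ∀ t, ∫ z : ℝ × ℝ, testFun n z.1 * (kernel ((z.1, y) - (z.2, t)) *
      (shellBump j t * profile freqBump j z.2)) ≤ -(c * 2 ^ j) * shellBump j t := fun t => by
    have e3 : ∀ z : ℝ × ℝ, testFun n z.1 * (kernel ((z.1, y) - (z.2, t)) *
        (shellBump j t * profile freqBump j z.2)) = shellBump j t *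
          (testFun n z.1 * profile freqBump j z.2 * kernel (z.1 - z.2, -(t - y))) := fun z => by
      rw [Prod.mk_sub_mk, neg_sub]; ring
    simp_rw [e3]
    rw [integral_const_mul, mul_comm (-(c * 2 ^ j))]
    by_cases ht : shellBump j t = 0
    · simp [ht]
    have ht' : t ∈ Function.support (shellBump j) := ht
    rw [support_shellBump, zpow_add₀ two_ne_zero, zpow_one] at ht'
    -- As `j ≤ n`, the height satisfies `t - y ≤ 2 · 2^{-j} + 2^{-n} ≤ 3 · 2^{-j}`; this is why `y`
    -- stays within `2^{-n}` of the axis.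
    have hnj : (2 : ℝ) ^ (-(n : ℤ)) ≤ 2 ^ (-(j : ℤ)) :=
      zpow_le_zpow_right₀ one_le_two (by have := (Finset.mem_Icc.1 hj).2; omega)
    have hj0 : (0 : ℝ) < 2 ^ (-(j : ℤ)) := by positivity
    refine mul_le_mul_of_nonneg_left (h n j (t - y) hj ?_ ?_) (shellBump j).nonneg
    · linarith [hy.2, ht'.1]
    · linarith [hy.1, ht'.2]
  rw [hswap]
  refine (integral_mono hJ ((integrable_shellBump j).const_mul _) hpt).trans ?_
  rw [integral_const_mul]
  have h1 := le_integral_shellBump j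
  have h2 : (2 : ℝ) ^ j * 2 ^ (-(j : ℤ)) = 1 := by
    rw [zpow_neg, zpow_natCast, mul_inv_cancel₀ (by positivity)]
  have h3 : 0 < c * 2 ^ j := by positivity
  have h4 : c * 2 ^ j * (1 / 2 * (2 : ℝ) ^ (-(j : ℤ))) = c / 2 := by
    linear_combination (c / 2) * h2
  linarith [mul_le_mul_of_nonneg_left h1 h3.le]

/-! ### The lower bound -/

lemma R₁₂_sum_tensorBump {f : ℝ × ℝ → ℂ} {n : ℕ}
    (hf : ∀ p, f p = ∑ j ∈ Finset.Icc 100 n, tensorBump freqBump (shellBump j) j p)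
    {p : ℝ × ℝ} (hp : p.2 < 0) :
    R₁₂ f p = ((∑ j ∈ Finset.Icc 100 n, shellTransform j p : ℝ) : ℂ) := by
  have hf' : ∀ q, f q = ((∑ j ∈ Finset.Icc 100 n,
      shellBump j q.2 * profile freqBump j q.1 : ℝ) : ℂ) := fun q => by
    rw [hf, Complex.ofReal_sum]
    exact Finset.sum_congr rfl fun j _ => tensorBump_eq integrable_freqBump _ j q
  rw [R₁₂_eq_integral_of_neg (fun q hq => ?_) hp]
  · simp_rw [hf', ← Complex.ofReal_mul, Finset.mul_sum]
    rw [integral_complex_ofReal, integral_finsetSum _ fun j _ => integrable_kernel_mul_tensor j hp]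
    rfl
  · rw [hf', Finset.sum_eq_zero, Complex.ofReal_zero]
    intro j _
    rw [shellBump_of_nonpos j hq, zero_mul]

lemma eLpNorm_testFun_le (n : ℕ) :
    eLpNorm (testFun n) 2 volume ≤ ENNReal.ofReal (√(n + 128)) := by
  have hbdd : ∀ x, ‖testFun n x‖ ≤ ∑ _k ∈ Finset.Icc 100 n, (1 : ℝ) := fun x => by
    refine norm_sum_le_of_le _ fun k _ => ?_
    rw [norm_mul, Real.norm_eq_abs, Real.norm_eq_abs, Real.abs_exp]
    exact mul_le_one₀ (Real.abs_sin_le_one _) (Real.exp_pos _).le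
      (Real.exp_le_one_iff.2 (by nlinarith [sq_nonneg x]))
  have hmem : MemLp (testFun n) 2 volume := by
    rw [memLp_two_iff_integrable_sq (continuous_testFun n).aestronglyMeasurable]
    simp_rw [sq]
    exact (integrable_testFun n).bdd_mul (continuous_testFun n).aestronglyMeasurable
      (.of_forall hbdd)
  rw [hmem.eLpNorm_eq_integral_rpow_norm two_ne_zero ENNReal.ofNat_ne_top, Real.sqrt_eq_rpow]
  refine ENNReal.ofReal_le_ofReal ?_
  simp only [ENNReal.toReal_ofNat, Real.rpow_ofNat, Real.norm_eq_abs, sq_abs, ← one_div]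
  exact Real.rpow_le_rpow (integral_nonneg fun x => sq_nonneg (testFun n x))
    (integral_testFun_sq_le n) (by norm_num)

lemma exists_le_eLpNorm_R₁₂ : ∃ c : ℝ, 0 < c ∧ ∀ (n : ℕ) (f : ℝ × ℝ → ℂ),
    (∀ p, f p = ∑ j ∈ Finset.Icc 100 n, tensorBump freqBump (shellBump j) j p) →
    ∀ y ∈ Set.Ioo (-(2 : ℝ) ^ (-(n : ℤ))) 0,
      ENNReal.ofReal (c * ((n : ℝ) - 99) / √(n + 128)) ≤
        eLpNorm (fun x => R₁₂ f (x, y)) 2 volume := by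
  obtain ⟨c, hc, h⟩ := exists_integral_testFun_mul_shellTransform_le
  refine ⟨c, hc, fun n f hf y hy => ?_⟩
  set Q : ℝ → ℝ := fun x => ∑ j ∈ Finset.Icc 100 n, shellTransform j (x, y) with hQ
  have hRQ : eLpNorm (fun x => R₁₂ f (x, y)) 2 volume = eLpNorm Q 2 volume := by
    refine eLpNorm_congr_norm_ae (.of_forall fun x => ?_)
    rw [R₁₂_sum_tensorBump hf hy.2, Complex.norm_real]
  have hQm : Measurable Q :=
    Finset.measurable_fun_sum _ fun j _ => measurable_shellTransform j y
  have hpair : ∫ x, testFun n x * Q x ≤ -(c * ((n : ℝ) - 99)) := by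
    have hi : ∀ j, Integrable fun x => testFun n x * shellTransform j (x, y) := fun j => by
      have := (integrable_testFun_mul_kernel n j hy.2).integral_prod_left
      simp_rw [integral_const_mul] at this
      exact this
    simp_rw [hQ, Finset.mul_sum]
    rw [integral_finsetSum _ fun j _ => hi j]
    refine (Finset.sum_le_sum fun j hj => h n j y hj hy).trans ?_
    rw [Finset.sum_const, Nat.card_Icc, nsmul_eq_mul]
    -- The number of scales is a truncated subtraction, so for `n < 99` only the inequality holds;
    -- the final bound is then trivial.
    have : (n : ℝ) - 99 ≤ ((n + 1 - 100 : ℕ) : ℝ) := by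
      rw [sub_le_iff_le_add]
      exact_mod_cast (by omega : n ≤ n + 1 - 100 + 99)
    nlinarith
  have hholder : ENNReal.ofReal (c * ((n : ℝ) - 99)) ≤
      ENNReal.ofReal (√(n + 128)) * eLpNorm Q 2 volume := by
    calc ENNReal.ofReal (c * ((n : ℝ) - 99)) ≤ ‖∫ x, testFun n x * Q x‖ₑ := by
          rw [← ofReal_norm]
          refine ENNReal.ofReal_le_ofReal ?_
          rw [Real.norm_eq_abs]
          exact le_trans (by linarith) (neg_le_abs _)
      _ ≤ ∫⁻ x, ‖testFun n x * Q x‖ₑ := enorm_integral_le_lintegral_enorm _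
      _ = eLpNorm (testFun n • Q) 1 volume := by
          rw [eLpNorm_one_eq_lintegral_enorm]; rfl
      _ ≤ eLpNorm (testFun n) 2 volume * eLpNorm Q 2 volume :=
          eLpNorm_smul_le_mul_eLpNorm hQm.aestronglyMeasurable
            (continuous_testFun n).aestronglyMeasurable
      _ ≤ _ := by gcongr; exact eLpNorm_testFun_le n
  have hs : 0 < √((n : ℝ) + 128) := Real.sqrt_pos.2 (by positivity)
  rw [hRQ, ENNReal.ofReal_div_of_pos hs]
  refine ENNReal.div_le_of_le_mul ?_
  rwa [mul_comm (eLpNorm _ _ _)]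

/-- The outer norm is an essential supremum, so a lower bound at one height would not do; an
interval has positive measure. -/
lemma le_normXthenY_top {F : ℝ × ℝ → ℂ} {v p : ℝ≥0∞} {a b : ℝ} (hab : a < b)
    (h : ∀ y ∈ Set.Ioo a b, v ≤ eLpNorm (fun x => F (x, y)) p volume) :
    v ≤ normXthenY p ∞ F := by
  unfold normXthenY
  rw [eLpNorm_exponent_top]
  have hae : ∀ᵐ y : ℝ, _ := enorm_ae_le_eLpNormEssSup
    (fun y : ℝ => eLpNorm (fun x => F (x, y)) p volume) volume
  obtain ⟨y, hy, hle⟩ : ∃ y ∈ Set.Ioo a b, eLpNorm (fun x => F (x, y)) p volume ≤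
      eLpNormEssSup (fun y : ℝ => eLpNorm (fun x => F (x, y)) p volume) volume := by
    by_contra! hcon
    have hsub : Set.Ioo a b ⊆ {y | ¬ ‖eLpNorm (fun x => F (x, y)) p volume‖ₑ ≤
        eLpNormEssSup (fun y : ℝ => eLpNorm (fun x => F (x, y)) p volume) volume} :=
      fun y hy => by simpa using hcon y hy
    have h0 := measure_mono_null hsub hae
    rw [Real.volume_Ioo, ENNReal.ofReal_eq_zero] at h0
    linarith
  exact (h y hy).trans hle

/-! ### Mixed norms of the sequence -/

lemma normYthenX_gaussWeighted_le {F : ℝ × ℝ → ℂ} {C : ℝ}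
    (hF : ∀ p : ℝ × ℝ, ‖F p‖ ≤ C * Real.exp (-(p.1 ^ 2 + p.2 ^ 2))) :
    normYthenX ∞ ∞ (gaussWeighted F) ≤ (C.toNNReal : ℝ≥0∞) := by
  unfold normYthenX
  simp only [eLpNorm_exponent_top]
  refine eLpNormEssSup_le_of_ae_enorm_bound (.of_forall fun x => ?_)
  rw [enorm_eq_self]
  refine eLpNormEssSup_le_of_ae_enorm_bound (.of_forall fun y => ?_)
  rw [← ofReal_norm, gaussWeighted, norm_mul, Complex.norm_real, Real.norm_eq_abs, Real.abs_exp]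
  refine ENNReal.ofReal_le_ofReal ?_
  calc Real.exp (x ^ 2 + y ^ 2) * ‖F (x, y)‖
      ≤ Real.exp (x ^ 2 + y ^ 2) * (C * Real.exp (-(x ^ 2 + y ^ 2))) := by
        gcongr; exact hF (x, y)
    _ = C := by
        rw [mul_left_comm, ← Real.exp_add, add_neg_cancel, Real.exp_zero, mul_one]

lemma exists_normYthenX_top_two_le {C : ℝ} (hC : 0 ≤ C) : ∃ B : ℝ≥0∞, B ≠ ∞ ∧ ∀ F : ℝ × ℝ → ℂ,
    (∀ p : ℝ × ℝ, ‖F p‖ ≤ C * Real.exp (-(p.1 ^ 2 + p.2 ^ 2))) → normYthenX ∞ 2 F ≤ B := by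
  have hcont : Continuous fun x : ℝ => C * Real.exp (-x ^ 2) := by fun_prop
  have hmem : MemLp (fun x : ℝ => C * Real.exp (-x ^ 2)) 2 volume := by
    rw [memLp_two_iff_integrable_sq hcont.aestronglyMeasurable]
    refine ((integrable_exp_neg_mul_sq (b := 2) two_pos).const_mul (C ^ 2)).congr
      (.of_forall fun x => ?_)
    simp only
    rw [mul_pow, ← Real.exp_nat_mul]
    congr 2
    push_cast
    ring
  refine ⟨_, hmem.2.ne, fun F hF => ?_⟩
  unfold normYthenX
  refine eLpNorm_mono_enorm fun x => ?_
  rw [enorm_eq_self, eLpNorm_exponent_top]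
  refine eLpNormEssSup_le_of_ae_enorm_bound (.of_forall fun y => ?_)
  rw [← ofReal_norm, Real.enorm_of_nonneg (by positivity)]
  refine ENNReal.ofReal_le_ofReal ((hF (x, y)).trans ?_)
  gcongr
  nlinarith [sq_nonneg y]

lemma tendsto_normXthenY_R₁₂ {g : ℕ → ℝ × ℝ → ℂ}
    (hg : ∀ n p, g n p = ∑ j ∈ Finset.Icc 100 n, tensorBump freqBump (shellBump j) j p) :
    Tendsto (fun n => normXthenY 2 ∞ (R₁₂ (g n))) atTop (𝓝 ∞) := by
  obtain ⟨c, hc, h⟩ := exists_le_eLpNorm_R₁₂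
  have hlower : ∀ n : ℕ, ENNReal.ofReal (c * ((n : ℝ) - 99) / √(n + 128)) ≤
      normXthenY 2 ∞ (R₁₂ (g n)) := fun n =>
    le_normXthenY_top (a := -(2 : ℝ) ^ (-(n : ℤ))) (b := 0) (neg_neg_of_pos (by positivity))
      (h n (g n) (hg n))
  refine tendsto_nhds_top_mono (ENNReal.tendsto_ofReal_nhds_top.2 ?_) (.of_forall hlower)
  have hsqrt : Tendsto (fun n : ℕ => √((n : ℝ) + 128)) atTop atTop :=
    Real.tendsto_sqrt_atTop.comp (tendsto_atTop_add_const_right _ _ tendsto_natCast_atTop_atTop)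
  -- With `r = √(n + 128) ≥ 1` one has `n - 99 = r² - 227`, so `(n - 99)/r ≥ r - 227`.
  refine tendsto_atTop_mono (fun n => ?_)
    ((tendsto_atTop_add_const_right _ (-227) hsqrt).const_mul_atTop hc)
  have h1 : (1 : ℝ) ≤ √((n : ℝ) + 128) := by
    rw [Real.one_le_sqrt]
    linarith [n.cast_nonneg (α := ℝ)]
  have h2 := Real.sq_sqrt (show (0 : ℝ) ≤ (n : ℝ) + 128 by positivity)
  rw [mul_div_assoc]
  refine mul_le_mul_of_nonneg_left ?_ hc.le
  rw [le_div_iff₀ (by linarith)]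
  nlinarith

end DoubleRiesz

end

/-! ### ### The main theorem -/

theorem proposition2p1 :
    -- the principal value defining `R₁₂ f` converges everywhere for every Schwartz function
    (∀ (f : 𝓢(ℝ × ℝ, ℂ)) (p : ℝ × ℝ),
      Tendsto (fun ε : ℝ => DoubleRiesz.truncated f ε p) (𝓝[>] 0)
        (𝓝 (DoubleRiesz.R₁₂ f p))) ∧
    -- the sequence `g n`, a sum of tensor bumps
    (∃ (A : ℝ) (χ : ℝ → ℝ) (χ₁ : ℕ → ℝ → ℝ) (g : ℕ → 𝓢(ℝ × ℝ, ℂ)),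
      3 ≤ A ∧ A ≤ 100 ∧
      DoubleRiesz.IsBump χ 0 A (1 / 4) (A - 1 / 4) ∧
      (∀ j : ℕ, DoubleRiesz.IsBump (χ₁ j)
        ((2 : ℝ) ^ (-(j : ℤ))) ((2 : ℝ) ^ (-(j : ℤ) + 1))
        ((2 : ℝ) ^ (-(j : ℤ)) + (2 : ℝ) ^ (-(j : ℤ) - 10))
        ((2 : ℝ) ^ (-(j : ℤ) + 1) - (2 : ℝ) ^ (-(j : ℤ) - 10))) ∧
      (∀ (n : ℕ) (p : ℝ × ℝ),
        g n p = ∑ j ∈ Finset.Icc 100 n, DoubleRiesz.tensorBump χ (χ₁ j) j p) ∧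
      (∃ C : ℝ≥0, ∀ n : ℕ,
        DoubleRiesz.normYthenX ∞ ∞ (DoubleRiesz.gaussWeighted (g n)) ≤ C) ∧
      (∀ n : ℕ, DoubleRiesz.normXthenY 2 ∞ (DoubleRiesz.R₁₂ (g n)) < ∞) ∧
      Tendsto (fun n : ℕ => DoubleRiesz.normXthenY 2 ∞ (DoubleRiesz.R₁₂ (g n)))
        atTop (𝓝 ∞)) ∧
    -- consequently both endpoint estimates fail
    (¬ ∃ C : ℝ≥0, ∀ f : 𝓢(ℝ × ℝ, ℂ),
      DoubleRiesz.normXthenY 2 ∞ (DoubleRiesz.R₁₂ f) ≤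
        C * DoubleRiesz.normYthenX ∞ ∞ (DoubleRiesz.gaussWeighted f)) ∧
    (¬ ∃ C : ℝ≥0, ∀ f : 𝓢(ℝ × ℝ, ℂ),
      DoubleRiesz.normXthenY 2 ∞ (DoubleRiesz.R₁₂ f) ≤
        C * DoubleRiesz.normYthenX ∞ 2 f) := by
  choose g hg using DoubleRiesz.exists_schwartz_sum_tensorBump
  obtain ⟨C, hC, hbound⟩ := DoubleRiesz.exists_norm_sum_tensorBump_le
  have hgC : ∀ (n : ℕ) (p : ℝ × ℝ), ‖g n p‖ ≤ C * Real.exp (-(p.1 ^ 2 + p.2 ^ 2)) :=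
    fun n p => by rw [hg]; exact hbound n p
  have hweight := fun n => DoubleRiesz.normYthenX_gaussWeighted_le (hgC n)
  have htend := DoubleRiesz.tendsto_normXthenY_R₁₂ (g := fun n => g n) hg
  -- Either estimate would give a finite bound independent of `n`, since the Gaussian majorant of `g
  -- n` controls both right-hand norms uniformly.
  have hunbdd : ∀ B : ℝ≥0∞, B ≠ ∞ →
      ¬ ∀ n, DoubleRiesz.normXthenY 2 ∞ (DoubleRiesz.R₁₂ (g n)) ≤ B :=
    fun B hB hle => hB (top_le_iff.1 (le_of_tendsto' htend hle))
  refine ⟨DoubleRiesz.tendsto_truncated,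
    ⟨3, DoubleRiesz.freqBump, fun j => DoubleRiesz.shellBump j, g, le_rfl, by norm_num,
      DoubleRiesz.isBump_freqBump, DoubleRiesz.isBump_shellBump, hg, ⟨_, hweight⟩,
      fun n => ?_, htend⟩, ?_, ?_⟩
  · obtain ⟨D, hD⟩ := DoubleRiesz.exists_norm_R₁₂_le (g n)
    exact DoubleRiesz.normXthenY_two_top_lt_top hD
  · rintro ⟨D, hD⟩
    refine hunbdd (D * C.toNNReal) (by finiteness) fun n => (hD (g n)).trans ?_
    gcongr
    exact hweight n
  · rintro ⟨D, hD⟩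
    obtain ⟨B, hB, hle⟩ := DoubleRiesz.exists_normYthenX_top_two_le hC
    refine hunbdd (D * B) (by finiteness) fun n => (hD (g n)).trans ?_
    gcongr
    exact hle _ (hgC n)
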